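/- Let $n\ge 1$. A weight is a nonnegative measurable function $w$ on $(0,\infty)$, locally integrable on $[0,\infty)$; put $W(t)=\int_0^t w(s)\,ds$. For measurable $f:\mathbb R^n\to[0,\infty)$ let $f^*$ be its decreasing rearrangement and $f^{**}(t)=\frac1t\int_0^t f^*(s)\,ds$. For a weight $w$ and $1\le q<\infty$ let $\Lambda^1(w)$, $\Gamma^q(w)$, $\Gamma^{1,\infty}(w)$ be the spaces of measurable $f:\mathbb R^n\to[0,\infty)$ for which, respectively, $$\|f\|_{\Lambda^1(w)}=\int_0^\infty f^*(t)w(t)\,dt,\qquad \|f\|_{\Gamma^q(w)}=\Big(\int_0^\infty f^{**}(t)^q w(t)\,dt\Big)^{1/q},\qquad \|f\|_{\Gamma^{1,\infty}(w)}=\sup_{t>0}f^{**}(t)W(t)$$ is finite (with $0\cdot\infty=0$). Let $w$ be a decreasing (that is, nonincreasing) weight. Then the following are equivalent: (i) There exist $1<q<\infty$ and a weight $v$ such that $\Lambda^1(w)=\Gamma^q(v)$. (ii) For every $1<q<\infty$ there is a weight $w_q$ such that, with constants independent of $r>0$, $$\Big(\int_0^r w(x)\,dx\Big)^q\approx\int_0^r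 w_q(x)\,dx+r^q\int_r^\infty w_q(x)\,\frac{dx}{x^q},\qquad(*)$$ and $\Lambda^1(w)=\Gamma^q(w_q)$ for every weight $w_q$ satisfying $(*)$. (iii) $\Lambda^1(w)=\Gamma^{1,\infty}(w)$, $w(\infty):=\lim_{t\to\infty}w(t)=0$ and $w\in L^1(0,\infty)$. Here an equality of spaces in (i), (ii), (iii) may be read either as equality of sets of functions or as equality with equivalent norms (i.e. $C^{-1}\|f\|\le\|f\|'\le C\|f\|$ for all $f$, with one constant $C$): the six resulting conditions are all equivalent. -/

import Mathlib

open Set Filter Topology MeasureTheory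
open scoped NNReal ENNReal

noncomputable section

namespace WeightedLorentz

/-- Euclidean space `ℝⁿ`. -/
abbrev Euc (n : ℕ) : Type := EuclideanSpace ℝ (Fin n)

/-- A weight on `(0,∞)`: a nonnegative measurable function that is locally integrable on `[0,∞)`,
so that `W(t) = ∫₀ᵗ w` is finite.  Only the values on `(0,∞)` are ever used. -/
structure IsWeight (w : ℝ → ℝ≥0) : Prop where
  measurable : Measurable w
  locallyIntegrable : LocallyIntegrableOn (fun t => (w t : ℝ)) (Ici 0) volume

/-- `W(t) = ∫₀ᵗ w(s) ds`. -/
def primitive (w : ℝ → ℝ≥0) (t : ℝ) : ℝ≥0∞ :=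
  ∫⁻ s in Ioc 0 t, (w s : ℝ≥0∞)

/-- The decreasing rearrangement `f*(t) = inf {s ≥ 0 : |{x : f x > s}| ≤ t}` (with `inf ∅ = ∞`). -/
def rearr {n : ℕ} (f : Euc n → ℝ≥0) (t : ℝ) : ℝ≥0∞ :=
  ⨅ (s : ℝ≥0) (_ : volume {x : Euc n | s < f x} ≤ ENNReal.ofReal t), (s : ℝ≥0∞)

/-- The maximal function `f**(t) = (1/t) ∫₀ᵗ f*(s) ds`, used for `t > 0`. -/
def maxRearr {n : ℕ} (f : Euc n → ℝ≥0) (t : ℝ) : ℝ≥0∞ :=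
  (∫⁻ s in Ioc 0 t, rearr f s) / ENNReal.ofReal t

/-- `‖f‖_{Λ^p(w)} = (∫₀^∞ f*(t)^p w(t) dt)^{1/p}`. -/
def lambdaNorm (n : ℕ) (p : ℝ) (w : ℝ → ℝ≥0) (f : Euc n → ℝ≥0) : ℝ≥0∞ :=
  (∫⁻ t in Ioi 0, rearr f t ^ p * (w t : ℝ≥0∞)) ^ (1 / p)

/-- `‖f‖_{Γ^p(w)} = (∫₀^∞ f**(t)^p w(t) dt)^{1/p}`. -/
def gammaNorm (n : ℕ) (p : ℝ) (w : ℝ → ℝ≥0) (f : Euc n → ℝ≥0) : ℝ≥0∞ :=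
  (∫⁻ t in Ioi 0, maxRearr f t ^ p * (w t : ℝ≥0∞)) ^ (1 / p)

/-- `‖f‖_{Γ^{p,∞}(w)} = sup_{t>0} f**(t) W(t)^{1/p}`. -/
def gammaWeakNorm (n : ℕ) (p : ℝ) (w : ℝ → ℝ≥0) (f : Euc n → ℝ≥0) : ℝ≥0∞ :=
  ⨆ (t : ℝ) (_ : 0 < t), maxRearr f t * primitive w t ^ (1 / p)

/-- The space of measurable `f : ℝⁿ → [0,∞)` on which a functional `ρ` is finite. -/
def space {n : ℕ} (ρ : (Euc n → ℝ≥0) → ℝ≥0∞) : Set (Euc n → ℝ≥0) :=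
  {f | Measurable f ∧ ρ f < ∞}

/-- The two functionals are equivalent: `C⁻¹ ρ(f) ≤ σ(f) ≤ C ρ(f)` for all measurable
`f : ℝⁿ → [0,∞)`.  In particular `ρ` and `σ` are finite on the same functions. -/
def NormEquiv {n : ℕ} (ρ σ : (Euc n → ℝ≥0) → ℝ≥0∞) : Prop :=
  ∃ C : ℝ≥0, 1 < C ∧ ∀ f : Euc n → ℝ≥0, Measurable f → ρ f ≤ C * σ f ∧ σ f ≤ C * ρ f

/-- `u` is a weight `w_q` for `w`: a weight with
`(∫₀ʳ w)^q ≈ ∫₀ʳ u(x) dx + r^q ∫_r^∞ u(x) x^{-q} dx`, uniformly in `r > 0`. -/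
def IsWq (w : ℝ → ℝ≥0) (q : ℝ) (u : ℝ → ℝ≥0) : Prop :=
  IsWeight u ∧
    ∃ C : ℝ≥0, 1 < C ∧ ∀ r : ℝ, 0 < r →
      let A : ℝ≥0∞ := primitive w r ^ q
      let B : ℝ≥0∞ := primitive u r +
        ENNReal.ofReal (r ^ q) * ∫⁻ x in Ioi r, (u x : ℝ≥0∞) / ENNReal.ofReal (x ^ q)
      A ≤ C * B ∧ B ≤ C * A

end WeightedLorentz

end

open WeightedLorentz

namespace WeightedLorentz

/-! Every condition is equivalent to a hidden one: $w$ is bounded and integrable on $(0,\infty)$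
(`IsBddIntegrable`). If it holds and $w$ is not identically zero on $(0,\infty)$, then
$W(r)\approx\min(1,r)$. Since $f^{**}(t)$ decreases and $t f^{**}(t)$ increases, all the norms in
question are equivalent to $f^{**}(1)$, the norm of $L^1+L^\infty$ (the `equivMaxRearrOne_*`
lemmas). The zero weight is treated apart.

Conversely, suppose $\Lambda^1(w)=\Gamma^q(v)$ as sets, with $w$ unbounded or not integrable. Then
some normalized functions $\chi_{(0,r_k)}/W(r_k)$ have $f^{**}\to0$ pointwise. If their $\Gamma^q$
norms are bounded along a subsequence, a gliding hump makes $\sum_j (j+1)^{-1}g_{k_j}$ lie in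
$\Gamma^q$, because $q>1$, while its $\Lambda^1$ norm is the harmonic series. Otherwise the norms
tend to infinity, and a sum with coefficients $2^{-j}$ lies in $\Lambda^1$ but not in $\Gamma^q$
(`space_lambda_ne_space_gamma`).

In (iii) integrability is given, and only boundedness must be shown. For unbounded $w$ a lacunary
sum of normalized characteristic functions has finite $\Gamma^{1,\infty}$ norm and infinite
$\Lambda^1$ norm (`isBddIntegrable_of_space_lambda_eq_gammaWeak`). Explicit counterexamples show
that equality of sets already suffices, without a closed graph argument. -/

/-! ### Functions with a prescribed rearrangement -/

/-- The volume of the ball on whose boundary `x` lies. -/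
noncomputable def ballVolume {n : ℕ} (x : Euc n) : ℝ :=
  (volume (Metric.ball (0 : Euc n) 1)).toReal * ‖x‖ ^ n

lemma measurable_ballVolume {n : ℕ} : Measurable (ballVolume (n := n)) := by
  unfold ballVolume
  fun_prop

lemma unitBall_volume_pos (n : ℕ) : 0 < (volume (Metric.ball (0 : Euc n) 1)).toReal :=
  ENNReal.toReal_pos (Metric.measure_ball_pos volume _ one_pos).ne' measure_ball_lt_top.ne

lemma ballVolume_pos {n : ℕ} {x : Euc n} (hx : x ≠ 0) : 0 < ballVolume x :=
  mul_pos (unitBall_volume_pos n) (pow_pos (norm_pos_iff.2 hx) n)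

lemma volume_ballVolume_lt {n : ℕ} (hn : 0 < n) {t : ℝ} (ht : 0 < t) :
    volume {x : Euc n | ballVolume x < t} = ENNReal.ofReal t := by
  have : Nonempty (Fin n) := ⟨⟨0, hn⟩⟩
  have ho := unitBall_volume_pos n
  set o := (volume (Metric.ball (0 : Euc n) 1)).toReal with hodef
  set ρ : ℝ := (t / o) ^ ((1 : ℝ) / n) with hρ
  have hto : 0 < t / o := div_pos ht ho
  have hρ0 : 0 < ρ := Real.rpow_pos_of_pos hto _
  have hρn : ρ ^ n = t / o := by
    rw [hρ, one_div, Real.rpow_inv_natCast_pow hto.le hn.ne']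
  have hset : {x : Euc n | ballVolume x < t} = Metric.ball 0 ρ := by
    ext x
    rw [Metric.mem_ball, dist_zero_right, mem_ofPred_eq, ballVolume, ← hodef,
      ← pow_lt_pow_iff_left₀ (norm_nonneg x) hρ0.le hn.ne', hρn, lt_div_iff₀' ho]
  rw [hset, Measure.addHaar_ball volume _ hρ0.le, finrank_euclideanSpace, Fintype.card_fin, hρn,
    ← ENNReal.ofReal_toReal (measure_ball_lt_top (μ := volume) (x := (0 : Euc n)) (r := 1)).ne,
    ← hodef, ← ENNReal.ofReal_mul hto.le, div_mul_cancel₀ _ ho.ne']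

/-- The radially decreasing function with profile `G`. -/
noncomputable def radial (n : ℕ) (G : ℝ → ℝ≥0∞) (x : Euc n) : ℝ≥0 := (G (ballVolume x)).toNNReal

lemma measurable_radial {n : ℕ} {G : ℝ → ℝ≥0∞} (hG : Antitone G) : Measurable (radial n G) :=
  (hG.measurable.comp measurable_ballVolume).ennreal_toNNReal

lemma rearr_radial_le {n : ℕ} (hn : 0 < n) {G : ℝ → ℝ≥0∞} (hG : Antitone G) {t : ℝ} (ht : 0 < t) :
    rearr (radial n G) t ≤ G t := by
  rcases eq_or_ne (G t) ∞ with h | h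
  · rw [h]; exact le_top
  · lift G t to ℝ≥0 using h with s hs
    refine iInf₂_le s ?_
    rw [← volume_ballVolume_lt hn ht]
    refine measure_mono fun x hx => ?_
    by_contra hc
    simp only [mem_ofPred_eq, not_lt] at hx hc
    have h1 := hG hc
    rw [← hs] at h1
    exact absurd (ENNReal.toNNReal_mono ENNReal.coe_ne_top h1) (not_le.2 hx)

/-- Finiteness of `G` matters because `toNNReal` in `radial` sends $\infty$ to $0$. It is needed
only for $t>0$, since the origin is a null set. -/
lemma le_rearr_radial {n : ℕ} (hn : 0 < n) {G : ℝ → ℝ≥0∞} (hG : Antitone G)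
    (hfin : ∀ t, 0 < t → G t ≠ ∞) {t t' : ℝ} (ht : 0 < t) (htt : t < t') :
    G t' ≤ rearr (radial n G) t := by
  refine le_iInf₂ fun s hs => ?_
  by_contra! hlt
  have : Nonempty (Fin n) := ⟨⟨0, hn⟩⟩
  have hsub : {x : Euc n | ballVolume x < t'} \ {0} ⊆ {x : Euc n | s < radial n G x} := by
    rintro x ⟨hx, hx0⟩
    have hp := ballVolume_pos hx0
    have h1 : (s : ℝ≥0∞) < G (ballVolume x) := hlt.trans_le (hG (le_of_lt hx))
    rw [← ENNReal.coe_toNNReal (hfin _ hp)] at h1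
    exact ENNReal.coe_lt_coe.1 h1
  have h2 := (measure_mono hsub).trans hs
  rw [measure_sdiff_null (measure_singleton _), volume_ballVolume_lt hn (ht.trans htt)] at h2
  exact absurd ((ENNReal.ofReal_le_ofReal_iff ht.le).1 h2) (not_le.2 htt)

/-- The gap between $t$ and $t'$ in the lower bound closes at continuity points of `G`, and a
monotone function has only countably many discontinuities. -/
lemma rearr_radial_ae {n : ℕ} (hn : 0 < n) {G : ℝ → ℝ≥0∞} (hG : Antitone G)
    (hfin : ∀ t, 0 < t → G t ≠ ∞) :
    ∀ᵐ t ∂volume.restrict (Ioi (0 : ℝ)), rearr (radial n G) t = G t := by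
  have hc : ∀ᵐ t : ℝ, ContinuousAt G t := hG.countable_not_continuousAt.ae_notMem volume |>.mono
    fun t ht => by simpa using ht
  filter_upwards [ae_restrict_mem measurableSet_Ioi, ae_restrict_of_ae hc] with t ht hct
  refine le_antisymm (rearr_radial_le hn hG ht) ?_
  refine le_of_tendsto (hct.tendsto.mono_left nhdsWithin_le_nhds : Tendsto G (𝓝[>] t) _) ?_
  filter_upwards [self_mem_nhdsWithin] with t' ht'
  exact le_rearr_radial hn hG hfin ht ht'

lemma lambdaNorm_radial {n : ℕ} (hn : 0 < n) {G : ℝ → ℝ≥0∞} (hG : Antitone G)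
    (hfin : ∀ t, 0 < t → G t ≠ ∞) (w : ℝ → ℝ≥0) :
    lambdaNorm n 1 w (radial n G) = ∫⁻ t in Ioi 0, G t * w t := by
  simp only [lambdaNorm, div_one, ENNReal.rpow_one]
  refine lintegral_congr_ae ?_
  filter_upwards [rearr_radial_ae hn hG hfin] with t ht
  rw [ht]

lemma maxRearr_radial {n : ℕ} (hn : 0 < n) {G : ℝ → ℝ≥0∞} (hG : Antitone G)
    (hfin : ∀ t, 0 < t → G t ≠ ∞) (t : ℝ) :
    maxRearr (radial n G) t = (∫⁻ s in Ioc 0 t, G s) / ENNReal.ofReal t := by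
  rw [maxRearr]
  congr 1
  exact lintegral_congr_ae
    (ae_mono (Measure.restrict_mono Ioc_subset_Ioi_self le_rfl) (rearr_radial_ae hn hG hfin))

/-! ### Decreasing step functions -/

/-- The decreasing step function `∑ c_j χ_{(-∞, r_j)}`. -/
noncomputable def stepFun (c : ℕ → ℝ≥0∞) (r : ℕ → ℝ) (t : ℝ) : ℝ≥0∞ :=
  ∑' j, c j * (Iio (r j)).indicator 1 t

/-- The value at `t` of `χ_{(0,r)}**`. -/
noncomputable def kernel (r t : ℝ) : ℝ≥0∞ := ENNReal.ofReal (min t r) / ENNReal.ofReal t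

lemma antitone_stepFun (c : ℕ → ℝ≥0∞) (r : ℕ → ℝ) : Antitone (stepFun c r) := by
  intro s t hst
  refine ENNReal.tsum_le_tsum fun j => ?_
  gcongr
  by_cases h : t < r j
  · simp [h, hst.trans_lt h]
  · simp [h]

lemma lintegral_stepFun_mul (c : ℕ → ℝ≥0∞) {r : ℕ → ℝ} {w : ℝ → ℝ≥0} (hw : Measurable w) :
    ∫⁻ t in Ioi 0, stepFun c r t * w t = ∑' j, c j * primitive w (r j) := by
  simp only [stepFun, ← ENNReal.tsum_mul_right]
  rw [lintegral_tsum fun j => by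
    have : Measurable ((Iio (r j)).indicator (1 : ℝ → ℝ≥0∞)) :=
      measurable_one.indicator measurableSet_Iio
    fun_prop]
  congr 1 with j
  have : ∀ t, c j * (Iio (r j)).indicator (1 : ℝ → ℝ≥0∞) t * w t
      = c j * (Iio (r j)).indicator (fun t => (w t : ℝ≥0∞)) t := by
    intro t
    by_cases h : t < r j <;> simp [h]
  simp only [this]
  rw [lintegral_const_mul _ (by
    have := hw.coe_nnreal_ennreal.indicator (measurableSet_Iio (a := r j)); exact this),
    lintegral_indicator measurableSet_Iio, Measure.restrict_restrict measurableSet_Iio, primitive,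
    inter_comm, Ioi_inter_Iio, restrict_Ioo_eq_restrict_Ioc]

lemma lintegral_stepFun_Ioc (c : ℕ → ℝ≥0∞) (r : ℕ → ℝ) (t : ℝ) :
    (∫⁻ s in Ioc 0 t, stepFun c r s) / ENNReal.ofReal t = ∑' j, c j * kernel (r j) t := by
  simp only [stepFun, kernel]
  rw [lintegral_tsum fun j => by
    have : Measurable ((Iio (r j)).indicator (1 : ℝ → ℝ≥0∞)) :=
      measurable_one.indicator measurableSet_Iio
    fun_prop, div_eq_mul_inv, ← ENNReal.tsum_mul_right]
  congr 1 with j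
  rw [lintegral_const_mul _ (measurable_one.indicator measurableSet_Iio),
    lintegral_indicator measurableSet_Iio, Measure.restrict_restrict measurableSet_Iio, mul_assoc,
    ← div_eq_mul_inv]
  congr 2
  simp only [Pi.one_apply, lintegral_const, one_mul, Measure.restrict_apply_univ]
  rcases le_or_gt (r j) t with h | h
  · rw [min_eq_right h, ← sub_zero (r j), ← Real.volume_Ioo, sub_zero]
    congr 1
    ext x
    simp only [mem_inter_iff, mem_Iio, mem_Ioc, mem_Ioo]
    grind
  · rw [min_eq_left h.le, ← sub_zero t, ← Real.volume_Ioc, sub_zero]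
    congr 1
    ext x
    simp only [mem_inter_iff, mem_Iio, mem_Ioc]
    grind

lemma measurable_kernel (r : ℝ) : Measurable (kernel r) := by
  unfold kernel
  fun_prop

lemma kernel_le_one (r t : ℝ) : kernel r t ≤ 1 :=
  ENNReal.div_le_of_le_mul (by rw [one_mul]; exact ENNReal.ofReal_le_ofReal (min_le_left _ _))

lemma kernel_le_div (r t : ℝ) : kernel r t ≤ ENNReal.ofReal r / ENNReal.ofReal t :=
  ENNReal.div_le_div_right (ENNReal.ofReal_le_ofReal (min_le_right _ _)) _

lemma indicator_Iio_le_kernel (r : ℝ) {t : ℝ} (ht : 0 < t) :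
    (Iio r).indicator 1 t ≤ kernel r t := by
  by_cases h : t < r
  · rw [kernel, min_eq_left h.le, ENNReal.div_self (by simpa using ht) ENNReal.ofReal_ne_top]
    simp [h]
  · simp [h]

lemma stepFun_le {c : ℕ → ℝ≥0∞} {r : ℕ → ℝ} {t : ℝ} (ht : 0 < t) :
    stepFun c r t ≤ ∑' j, c j * kernel (r j) t :=
  ENNReal.tsum_le_tsum fun _ => mul_le_mul_right (indicator_Iio_le_kernel _ ht) _

lemma indicator_Iio_le_kernel_of_le (r : ℝ) {s t : ℝ} (hs : 0 < s) (hst : s ≤ t) :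
    (Iio r).indicator 1 t ≤ kernel r s := by
  by_cases h : t < r
  · refine le_trans ?_ (indicator_Iio_le_kernel r hs)
    rw [indicator_of_mem (mem_Iio.2 h), indicator_of_mem (mem_Iio.2 (hst.trans_lt h))]
    rfl
  · simp [h]

/-- Makes infinite sums admissible as profiles for `radial`. The sample points $1/(j+1)$ eventually
lie below any fixed $t$, so a geometric series dominates the tail at $t$. -/
lemma stepFun_ne_top {c : ℕ → ℝ≥0∞} {r : ℕ → ℝ} (hc : ∀ j, c j ≠ ∞)
    (hs : ∀ j : ℕ, c j * kernel (r j) (1 / ((j : ℝ) + 1)) ≤ (2⁻¹ : ℝ≥0∞) ^ j) {t : ℝ}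
    (ht : 0 < t) : stepFun c r t ≠ ∞ := by
  obtain ⟨N, hN⟩ := exists_nat_one_div_lt ht
  have htail : ∀ i : ℕ, c (i + N) * (Iio (r (i + N))).indicator 1 t ≤ (2⁻¹ : ℝ≥0∞) ^ i := by
    intro i
    have hi : 1 / (((i + N : ℕ) : ℝ) + 1) ≤ t :=
      (one_div_le_one_div_of_le (by positivity) (by simp)).trans hN.le
    refine (mul_le_mul_right
      (indicator_Iio_le_kernel_of_le (r (i + N)) (by positivity) hi) _).trans ?_
    exact (hs (i + N)).trans (pow_le_pow_right_of_le_one' (by simp) (Nat.le_add_right i N))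
  have hhead : ∑ j ∈ Finset.range N, c j * (Iio (r j)).indicator 1 t < ∞ := by
    refine ENNReal.sum_lt_top.2 fun j _ => ENNReal.mul_lt_top (hc j).lt_top ?_
    by_cases h : t < r j <;> simp [h]
  have hgeom : ∑' i : ℕ, (2⁻¹ : ℝ≥0∞) ^ i < ∞ := by simp [ENNReal.tsum_geometric]
  rw [stepFun, ← Summable.sum_add_tsum_nat_add' (k := N) ENNReal.summable]
  exact (ENNReal.add_lt_top.2 ⟨hhead, (ENNReal.tsum_le_tsum htail).trans_lt hgeom⟩).ne

/-! ### Comparing `Λ¹(w)` with `Γ^q(v)` -/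

/-- The first term is at most $(2x)^q$, so dominated convergence applies to it; the second involves
$y$ alone. -/
lemma add_rpow_le (x y : ℝ≥0∞) {q : ℝ} (hq : 0 ≤ q) :
    (x + y) ^ q ≤ (x + min x y) ^ q + (2 * y) ^ q := by
  rcases le_total y x with h | h
  · rw [min_eq_right h]; exact le_self_add
  · refine le_trans (ENNReal.rpow_le_rpow ?_ hq) le_add_self
    rw [two_mul]; gcongr

lemma eventually_lintegral_add_rpow_le {α : Type*} {m : MeasurableSpace α} {μ : Measure α} {q : ℝ}
    (hq : 0 < q) {S : α → ℝ≥0∞} {h : ℕ → α → ℝ≥0∞} (hS : Measurable S) (hh : ∀ k, Measurable (h k))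
    (hfin : ∫⁻ t, S t ^ q ∂μ ≠ ∞) (hlim : ∀ᵐ t ∂μ, Tendsto (fun k => h k t) atTop (𝓝 0))
    {ε : ℝ≥0∞} (hε : ε ≠ 0) :
    ∀ᶠ k in atTop, ∫⁻ t, (S t + h k t) ^ q ∂μ
      ≤ ∫⁻ t, S t ^ q ∂μ + ε + ∫⁻ t, (2 * h k t) ^ q ∂μ := by
  have key : Tendsto (fun k => ∫⁻ t, (S t + min (S t) (h k t)) ^ q ∂μ) atTop
      (𝓝 (∫⁻ t, S t ^ q ∂μ)) := by
    refine tendsto_lintegral_of_dominated_convergence (fun t => 2 ^ q * S t ^ q)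
      (fun k => by fun_prop) (fun k => ae_of_all _ fun t => ?_) ?_ ?_
    · beta_reduce
      rw [← ENNReal.mul_rpow_of_nonneg _ _ hq.le, two_mul]
      gcongr
      exact min_le_left _ _
    · rw [lintegral_const_mul _ (by fun_prop)]
      exact ENNReal.mul_ne_top (ENNReal.rpow_ne_top_of_nonneg hq.le (by simp)) hfin
    · filter_upwards [hlim] with t ht
      refine (ENNReal.continuous_rpow_const.tendsto _).comp ?_
      have : Tendsto (fun k => S t + min (S t) (h k t)) atTop (𝓝 (S t + min (S t) 0)) :=
        tendsto_const_nhds.add (tendsto_const_nhds.min ht)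
      simpa using this
  have hlt : ∫⁻ t, S t ^ q ∂μ < ∫⁻ t, S t ^ q ∂μ + ε := ENNReal.lt_add_right hfin hε
  filter_upwards [key.eventually_lt_const hlt] with k hk
  calc ∫⁻ t, (S t + h k t) ^ q ∂μ
      ≤ ∫⁻ t, ((S t + min (S t) (h k t)) ^ q + (2 * h k t) ^ q) ∂μ :=
        lintegral_mono fun t => add_rpow_le _ _ hq.le
    _ = ∫⁻ t, (S t + min (S t) (h k t)) ^ q ∂μ + ∫⁻ t, (2 * h k t) ^ q ∂μ :=
        lintegral_add_left (by fun_prop) _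
    _ ≤ _ := by gcongr

lemma tsum_inv_add_one : ∑' j : ℕ, ((((j : ℝ≥0) + 1)⁻¹ : ℝ≥0) : ℝ≥0∞) = ∞ := by
  by_contra h
  have h1 : Summable fun j : ℕ => ((((j : ℝ≥0) + 1)⁻¹ : ℝ≥0) : ℝ) :=
    NNReal.summable_coe.2 (ENNReal.tsum_coe_ne_top_iff_summable.1 h)
  refine Real.not_summable_one_div_natCast ((summable_nat_add_iff 1).1 (h1.congr fun j => ?_))
  push_cast
  rw [one_div]

lemma tsum_inv_add_one_rpow {q : ℝ} (hq : 1 < q) :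
    ∑' j : ℕ, ((((j : ℝ≥0) + 1)⁻¹ : ℝ≥0) : ℝ≥0∞) ^ q ≠ ∞ := by
  have h0 : (0 : ℝ) ≤ q := by linarith
  simp only [← ENNReal.coe_rpow_of_nonneg _ h0]
  rw [ENNReal.tsum_coe_ne_top_iff_summable, ← NNReal.summable_coe]
  refine ((summable_nat_add_iff 1).2 (Real.summable_one_div_nat_rpow.2 hq)).congr fun j => ?_
  push_cast
  rw [one_div, Real.inv_rpow (by positivity)]

/-- The gliding hump: a sequence bounded in `L^q`, `q > 1`, which tends to `0` pointwise has a
subsequence for which `∑ g_{k_j} / (j+1)` is in `L^q`; the `j`-th index may moreover be required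
to satisfy any eventual property `P j`. -/
lemma exists_subseq_lintegral_tsum_lt_top {α : Type*} {m : MeasurableSpace α} {μ : Measure α}
    {q : ℝ} (hq : 1 < q) {g : ℕ → α → ℝ≥0∞} (hg : ∀ k, Measurable (g k))
    (hlim : ∀ᵐ t ∂μ, Tendsto (fun k => g k t) atTop (𝓝 0)) {M : ℝ≥0∞} (hM : M ≠ ∞)
    (hfreq : ∃ᶠ k in atTop, ∫⁻ t, g k t ^ q ∂μ ≤ M) (P : ℕ → ℕ → Prop)
    (hP : ∀ j, ∀ᶠ k in atTop, P j k) :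
    ∃ κ : ℕ → ℕ, (∀ j, P j (κ j)) ∧
      ∫⁻ t, (∑' j : ℕ, ((((j : ℝ≥0) + 1)⁻¹ : ℝ≥0) : ℝ≥0∞) * g (κ j) t) ^ q ∂μ < ∞ := by
  have hq0 : 0 < q := by linarith
  set a : ℕ → ℝ≥0∞ := fun j => (((j : ℝ≥0) + 1)⁻¹ : ℝ≥0) with ha
  have ha0 : ∀ j, a j ≠ 0 := fun j => by
    simp only [ha, ne_eq, ENNReal.coe_eq_zero, inv_eq_zero]; positivity
  have hatop : ∀ j, a j ≠ ∞ := fun j => ENNReal.coe_ne_top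
  -- The conditions on `S` sit under the existential so that `choose` gives an index for every `S`.
  -- The error $\varepsilon=a_j^q$ keeps each increment a multiple of $a_j^q$, which is summable as
  -- $q>1$.
  have step : ∀ (S : α → ℝ≥0∞) (j : ℕ), ∃ k, P j k ∧ (Measurable S → ∫⁻ t, S t ^ q ∂μ ≠ ∞ →
      ∫⁻ t, (S t + a j * g k t) ^ q ∂μ ≤ ∫⁻ t, S t ^ q ∂μ + a j ^ q * (1 + 2 ^ q * M)) := by
    intro S j
    by_cases hS : Measurable S ∧ ∫⁻ t, S t ^ q ∂μ ≠ ∞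
    · have hl : ∀ᵐ t ∂μ, Tendsto (fun k => a j * g k t) atTop (𝓝 0) := by
        filter_upwards [hlim] with t ht
        simpa using ENNReal.Tendsto.const_mul ht (Or.inr (hatop j))
      have hev := eventually_lintegral_add_rpow_le (μ := μ) hq0 hS.1
        (h := fun k t => a j * g k t) (fun k => (hg k).const_mul _) hS.2 hl
        (ε := a j ^ q) (by simp [ENNReal.rpow_eq_zero_iff, ha0, hatop])
      obtain ⟨k, hk, hk1, hk2⟩ := (hfreq.and_eventually (hev.and (hP j))).exists
      refine ⟨k, hk2, fun _ _ => hk1.trans ?_⟩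
      rw [add_assoc, mul_add, mul_one]
      gcongr
      calc ∫⁻ t, (2 * (a j * g k t)) ^ q ∂μ = ∫⁻ t, (a j ^ q * 2 ^ q) * g k t ^ q ∂μ := by
            congr 1 with t
            rw [← ENNReal.mul_rpow_of_nonneg _ _ hq0.le, ← ENNReal.mul_rpow_of_nonneg _ _ hq0.le]
            congr 1; ring
        _ = (a j ^ q * 2 ^ q) * ∫⁻ t, g k t ^ q ∂μ := by
            rw [lintegral_const_mul _ ((hg k).pow_const q)]
        _ ≤ a j ^ q * (2 ^ q * M) := by rw [mul_assoc]; gcongr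
    · obtain ⟨k, hk⟩ := (hP j).exists
      exact ⟨k, hk, fun h1 h2 => absurd ⟨h1, h2⟩ hS⟩
  choose κ hκP hκ using step
  -- The partial sums are defined recursively because the next index depends on the sum built so
  -- far.
  let S : ℕ → α → ℝ≥0∞ := fun N =>
    Nat.rec (fun _ => 0) (fun j S t => S t + a j * g (κ S j) t) N
  have hSs : ∀ N t, S (N + 1) t = S N t + a N * g (κ (S N) N) t := fun N t => rfl
  have hSsum : ∀ N t, S N t = ∑ j ∈ Finset.range N, a j * g (κ (S j) j) t := by
    intro N t
    induction N with
    | zero => rfl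
    | succ N ih => rw [hSs, ih, Finset.sum_range_succ]
  have hSm : ∀ N, Measurable (S N) := by
    intro N
    have : S N = fun t => ∑ j ∈ Finset.range N, a j * g (κ (S j) j) t := funext (hSsum N)
    rw [this]
    fun_prop
  have hC : 1 + 2 ^ q * M ≠ ∞ := ENNReal.add_ne_top.2 ⟨by simp,
    ENNReal.mul_ne_top (ENNReal.rpow_ne_top_of_nonneg hq0.le (by simp)) hM⟩
  have hbound : ∀ N, ∫⁻ t, S N t ^ q ∂μ ≤ ∑ j ∈ Finset.range N, a j ^ q * (1 + 2 ^ q * M) := by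
    intro N
    induction N with
    | zero => simp [S, ENNReal.zero_rpow_of_pos hq0]
    | succ N ih =>
      have hf : ∫⁻ t, S N t ^ q ∂μ ≠ ∞ := ne_top_of_le_ne_top
        (ENNReal.sum_lt_top.2 fun j _ => (ENNReal.mul_ne_top
          (ENNReal.rpow_ne_top_of_nonneg hq0.le (hatop j)) hC).lt_top).ne ih
      rw [Finset.sum_range_succ]
      exact (hκ (S N) N (hSm N) hf).trans (by gcongr)
  refine ⟨fun j => κ (S j) j, fun j => hκP _ _, ?_⟩
  have hmono : Monotone S := monotone_nat_of_le_succ fun N t => by rw [hSs]; exact le_self_add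
  have hlimS : ∀ t, (∑' j, a j * g (κ (S j) j) t) ^ q = ⨆ N, S N t ^ q := by
    intro t
    rw [ENNReal.tsum_eq_iSup_nat]
    simp only [← hSsum]
    exact (ENNReal.orderIsoRpow q hq0).map_iSup _
  change ∫⁻ t, (∑' j, a j * g (κ (S j) j) t) ^ q ∂μ < ∞
  simp only [hlimS]
  rw [lintegral_iSup (fun N => (hSm N).pow_const q)
    (fun N N' h t => ENNReal.rpow_le_rpow (hmono h t) hq0.le)]
  refine lt_of_le_of_lt (iSup_le fun N => (hbound N).trans (ENNReal.sum_le_tsum _)) ?_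
  rw [ENNReal.tsum_mul_right]
  exact ENNReal.mul_lt_top (tsum_inv_add_one_rpow hq).lt_top hC.lt_top

/-! ### Counterexamples to equality of the spaces -/

lemma gammaNorm_lt_top_iff {n : ℕ} {q : ℝ} (hq : 0 < q) {v : ℝ → ℝ≥0} {f : Euc n → ℝ≥0} :
    gammaNorm n q v f < ∞ ↔ ∫⁻ t in Ioi 0, maxRearr f t ^ q * v t < ∞ := by
  rw [gammaNorm, ENNReal.rpow_lt_top_iff_of_pos (by positivity)]

/-- What equality of the spaces says about radial step functions. -/
lemma tsum_lt_top_iff_of_space_eq {n : ℕ} (hn : 0 < n) {w v : ℝ → ℝ≥0} (hw : Measurable w)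
    {q : ℝ} (hq : 0 < q) (heq : space (lambdaNorm n 1 w) = space (gammaNorm n q v))
    {c : ℕ → ℝ≥0∞} {r : ℕ → ℝ} (hfin : ∀ t, 0 < t → stepFun c r t ≠ ∞) :
    ∑' j, c j * primitive w (r j) < ∞ ↔
      ∫⁻ t in Ioi 0, (∑' j, c j * kernel (r j) t) ^ q * v t < ∞ := by
  have hG := antitone_stepFun c r
  have h : radial n (stepFun c r) ∈ space (lambdaNorm n 1 w) ↔
      radial n (stepFun c r) ∈ space (gammaNorm n q v) := by rw [heq]
  simp only [space, mem_ofPred_eq, measurable_radial hG, true_and, gammaNorm_lt_top_iff hq,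
    lambdaNorm_radial hn hG hfin, maxRearr_radial hn hG hfin, lintegral_stepFun_mul c hw,
    lintegral_stepFun_Ioc] at h
  exact h

/-- The functions `g k` are the $f^{**}$ of characteristic functions normalized in $\Lambda^1(w)$.
Bounded or unbounded in $\Gamma^q(v)$, they can be summed to a function in exactly one of the
spaces. -/
lemma space_lambda_ne_space_gamma {n : ℕ} (hn : 0 < n) {w v : ℝ → ℝ≥0} (hw : Measurable w)
    (hv : Measurable v) {q : ℝ} (hq : 1 < q) {r : ℕ → ℝ}
    (hW0 : ∀ k, primitive w (r k) ≠ 0) (hWtop : ∀ k, primitive w (r k) ≠ ∞)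
    (hlim : ∀ t, 0 < t → Tendsto (fun k => (primitive w (r k))⁻¹ * kernel (r k) t) atTop (𝓝 0)) :
    space (lambdaNorm n 1 w) ≠ space (gammaNorm n q v) := by
  intro heq
  have hq0 : 0 < q := by linarith
  set c : ℕ → ℝ≥0∞ := fun k => (primitive w (r k))⁻¹ with hc
  have hctop : ∀ k, c k ≠ ∞ := fun k => ENNReal.inv_ne_top.2 (hW0 k)
  have hcW : ∀ k, c k * primitive w (r k) = 1 := fun k => ENNReal.inv_mul_cancel (hW0 k) (hWtop k)
  set g : ℕ → ℝ → ℝ≥0∞ := fun k t => c k * kernel (r k) t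
  have hgm : ∀ k, Measurable (g k) := fun k => (measurable_kernel _).const_mul _
  have hsmall : ∀ j : ℕ, ∀ᶠ k in atTop, g k (1 / ((j : ℝ) + 1)) ≤ (2⁻¹ : ℝ≥0∞) ^ j := fun j =>
    (hlim _ (by positivity)).eventually_le_const
      (ENNReal.pow_pos (by simp) j)
  by_cases hcase : ∃ M : ℝ≥0∞, M ≠ ∞ ∧ ∃ᶠ k in atTop, ∫⁻ t in Ioi 0, g k t ^ q * v t ≤ M
  · obtain ⟨M, hM, hfreq⟩ := hcase
    have hconv : ∀ F : ℝ → ℝ≥0∞, Measurable F →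
        ∫⁻ t, F t ∂((volume.restrict (Ioi 0)).withDensity fun t => (v t : ℝ≥0∞))
          = ∫⁻ t in Ioi 0, F t * v t := fun F hF => by
      rw [lintegral_withDensity_eq_lintegral_mul _ hv.coe_nnreal_ennreal hF]
      exact lintegral_congr fun t => mul_comm _ _
    obtain ⟨κ, hκ, hint⟩ := exists_subseq_lintegral_tsum_lt_top
      (μ := (volume.restrict (Ioi 0)).withDensity fun t => (v t : ℝ≥0∞)) hq hgm
      ((withDensity_absolutelyContinuous _ _).ae_le
        ((ae_restrict_mem measurableSet_Ioi).mono fun t ht => hlim t ht)) hM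
      (hfreq.mono fun k hk => by rwa [hconv _ ((hgm k).pow_const q)]) _ hsmall
    rw [hconv _ (by fun_prop)] at hint
    have ha : ∀ j : ℕ, ((((j : ℝ≥0) + 1)⁻¹ : ℝ≥0) : ℝ≥0∞) ≤ 1 := fun j => by
      rw [ENNReal.coe_le_one_iff]
      exact inv_le_one_of_one_le₀ (by simp)
    have hiff := tsum_lt_top_iff_of_space_eq hn hw hq0 heq
      (c := fun j => ((((j : ℝ≥0) + 1)⁻¹ : ℝ≥0) : ℝ≥0∞) * c (κ j)) (r := fun j => r (κ j))
      fun t ht => stepFun_ne_top (fun j => ENNReal.mul_ne_top ENNReal.coe_ne_top (hctop _))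
        (fun j => le_trans (by rw [mul_assoc]; exact mul_le_of_le_one_left' (ha j)) (hκ j)) ht
    simp only [mul_assoc, hcW, mul_one] at hiff
    exact absurd (hiff.2 hint) (by rw [tsum_inv_add_one]; simp)
  · push Not at hcase
    -- The size $j\,2^{jq}$ is chosen so that, after the factor $2^{-j}$, the $j$-th term alone
    -- contributes at least $j$.
    have hex : ∀ j : ℕ, ∃ k, g k (1 / ((j : ℝ) + 1)) ≤ (2⁻¹ : ℝ≥0∞) ^ j ∧
        j * (2 ^ j) ^ q ≤ ∫⁻ t in Ioi 0, g k t ^ q * v t := fun j => by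
      have h1 := hcase (j * (2 ^ j) ^ q)
        (ENNReal.mul_ne_top (by simp) (ENNReal.rpow_ne_top_of_nonneg hq0.le (by simp)))
      exact ((hsmall j).and (h1.mono fun k hk => hk.le)).exists
    choose κ hκ hbig using hex
    have ha : ∀ j : ℕ, (2⁻¹ : ℝ≥0∞) ^ j ≤ 1 := fun j => pow_le_one' (by simp) j
    have hiff := tsum_lt_top_iff_of_space_eq hn hw hq0 heq
      (c := fun j => (2⁻¹ : ℝ≥0∞) ^ j * c (κ j)) (r := fun j => r (κ j))
      fun t ht => stepFun_ne_top (fun j => ENNReal.mul_ne_top (by simp) (hctop _))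
        (fun j => le_trans (by rw [mul_assoc]; exact mul_le_of_le_one_left' (ha j)) (hκ j)) ht
    simp only [mul_assoc, hcW, mul_one] at hiff
    have hlt := hiff.1 (by simp [ENNReal.tsum_geometric])
    obtain ⟨j, hj⟩ := ENNReal.exists_nat_gt hlt.ne
    refine absurd hj (not_lt.2 ?_)
    calc (j : ℝ≥0∞) = ((2⁻¹ : ℝ≥0∞) ^ j) ^ q * (j * (2 ^ j) ^ q) := by
          rw [mul_left_comm, ← ENNReal.mul_rpow_of_nonneg _ _ hq0.le, ← mul_pow,
            ENNReal.inv_mul_cancel (by simp) (by simp), one_pow, ENNReal.one_rpow, mul_one]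
      _ ≤ ((2⁻¹ : ℝ≥0∞) ^ j) ^ q * ∫⁻ t in Ioi 0, g (κ j) t ^ q * v t := by
          gcongr; exact hbig j
      _ = ∫⁻ t in Ioi 0, ((2⁻¹ : ℝ≥0∞) ^ j * g (κ j) t) ^ q * v t := by
          rw [← lintegral_const_mul _ (by have := hgm (κ j); fun_prop)]
          congr 1 with t
          rw [ENNReal.mul_rpow_of_nonneg (2⁻¹ ^ j) (g (κ j) t) hq0.le, mul_assoc]
      _ ≤ _ := by
          refine lintegral_mono fun t => ?_
          gcongr
          exact ENNReal.le_tsum (f := fun j => (2⁻¹ : ℝ≥0∞) ^ j * g (κ j) t) j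

/-! ### Primitives of decreasing functions -/

lemma mul_ofReal_le_lintegral {F : ℝ → ℝ≥0∞} (hF : AntitoneOn F (Ioi 0)) {t : ℝ} (ht : 0 < t) :
    F t * ENNReal.ofReal t ≤ ∫⁻ s in Ioc 0 t, F s := by
  calc F t * ENNReal.ofReal t = ∫⁻ _ in Ioc 0 t, F t := by simp
    _ ≤ _ := setLIntegral_mono' measurableSet_Ioc fun s hs => hF hs.1 ht hs.2

/-- Averages of a decreasing function decrease, cross-multiplied to avoid division: on $(s,t]$ the
values are at most $F(s)$, hence at most the mean over $(0,s]$. -/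
lemma lintegral_mul_ofReal_le {F : ℝ → ℝ≥0∞} (hF : AntitoneOn F (Ioi 0)) {s t : ℝ} (hs : 0 < s)
    (hst : s ≤ t) :
    (∫⁻ x in Ioc 0 t, F x) * ENNReal.ofReal s ≤ (∫⁻ x in Ioc 0 s, F x) * ENNReal.ofReal t := by
  have h1 : ∫⁻ x in Ioc s t, F x ≤ F s * ENNReal.ofReal (t - s) :=
    calc ∫⁻ x in Ioc s t, F x ≤ ∫⁻ _ in Ioc s t, F s :=
          setLIntegral_mono' measurableSet_Ioc fun x hx => hF hs (hs.trans hx.1) hx.1.le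
      _ = _ := by simp
  have h2 := mul_ofReal_le_lintegral hF hs
  rw [← Ioc_union_Ioc_eq_Ioc hs.le hst,
    lintegral_union measurableSet_Ioc (Ioc_disjoint_Ioc_of_le le_rfl)]
  calc ((∫⁻ x in Ioc 0 s, F x) + ∫⁻ x in Ioc s t, F x) * ENNReal.ofReal s
      ≤ (∫⁻ x in Ioc 0 s, F x) * ENNReal.ofReal s
        + F s * ENNReal.ofReal (t - s) * ENNReal.ofReal s := by rw [add_mul]; gcongr
    _ = (∫⁻ x in Ioc 0 s, F x) * ENNReal.ofReal s
        + F s * ENNReal.ofReal s * ENNReal.ofReal (t - s) := by rw [mul_right_comm]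
    _ ≤ (∫⁻ x in Ioc 0 s, F x) * ENNReal.ofReal s
        + (∫⁻ x in Ioc 0 s, F x) * ENNReal.ofReal (t - s) := by gcongr
    _ = _ := by
        rw [← mul_add, ← ENNReal.ofReal_add hs.le (sub_nonneg.2 hst), add_sub_cancel]

lemma lintegral_Ioi_zero_le_of_forall_Ioc {F : ℝ → ℝ≥0∞} {C : ℝ≥0∞}
    (h : ∀ r, 0 < r → ∫⁻ x in Ioc 0 r, F x ≤ C) : ∫⁻ x in Ioi 0, F x ≤ C := by
  have hU : Ioi (0 : ℝ) = ⋃ k : ℕ, Ioc 0 ((k : ℝ) + 1) := by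
    ext x
    simp only [mem_Ioi, mem_iUnion, mem_Ioc]
    refine ⟨fun hx => ?_, fun ⟨_, hx, _⟩ => hx⟩
    obtain ⟨k, hk⟩ := exists_nat_gt x
    exact ⟨k, hx, by linarith⟩
  rw [hU, setLIntegral_iUnion_of_directed]
  · exact iSup_le fun k => h _ (by positivity)
  · refine Monotone.directed_le fun i j hij => Ioc_subset_Ioc_right ?_
    have : (i : ℝ) ≤ j := by exact_mod_cast hij
    linarith

lemma lintegral_Ioi_zero_le_of_forall_Ioi {F : ℝ → ℝ≥0∞} {C : ℝ≥0∞}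
    (h : ∀ r, 0 < r → ∫⁻ x in Ioi r, F x ≤ C) : ∫⁻ x in Ioi 0, F x ≤ C := by
  have hU : Ioi (0 : ℝ) = ⋃ k : ℕ, Ioi (1 / ((k : ℝ) + 1)) := by
    ext x
    simp only [mem_Ioi, mem_iUnion]
    refine ⟨fun hx => exists_nat_one_div_lt hx, fun ⟨k, hk⟩ => lt_trans (by positivity) hk⟩
  rw [hU, setLIntegral_iUnion_of_directed]
  · exact iSup_le fun k => h _ (by positivity)
  · refine Monotone.directed_le fun i j hij => Ioi_subset_Ioi ?_
    exact Nat.one_div_le_one_div hij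

/-! ### Decreasing weights and the necessity of `IsBddIntegrable` for (i) -/

section Weight

variable {w : ℝ → ℝ≥0}

lemma antitoneOn_coe (hdec : AntitoneOn w (Ioi 0)) :
    AntitoneOn (fun t => (w t : ℝ≥0∞)) (Ioi 0) :=
  fun _ hs _ ht hst => ENNReal.coe_le_coe.2 (hdec hs ht hst)

lemma primitive_mono (w : ℝ → ℝ≥0) : Monotone (primitive w) := fun _ _ h =>
  lintegral_mono_set (Ioc_subset_Ioc_right h)

lemma IsWeight.primitive_ne_top (hw : IsWeight w) (r : ℝ) : primitive w r ≠ ∞ := by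
  have h1 : IntegrableOn (fun t => (w t : ℝ)) (Icc 0 r) volume :=
    hw.locallyIntegrable.integrableOn_compact_subset Icc_subset_Ici_self isCompact_Icc
  have h2 := (h1.mono_set Ioc_subset_Icc_self).2
  rw [hasFiniteIntegral_iff_enorm] at h2
  have h3 : ∀ t, ‖(w t : ℝ)‖ₑ = w t := fun t => by
    rw [Real.enorm_eq_ofReal (w t).coe_nonneg, ENNReal.ofReal_coe_nnreal]
  simp only [h3] at h2
  exact h2.ne

lemma primitive_pos (hdec : AntitoneOn w (Ioi 0)) (hne : ∃ t, 0 < t ∧ w t ≠ 0) {r : ℝ}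
    (hr : 0 < r) : primitive w r ≠ 0 := by
  obtain ⟨t, ht, hwt⟩ := hne
  have hm : 0 < min t r := lt_min ht hr
  have h1 : w (min t r) ≠ 0 := fun h0 =>
    hwt (le_antisymm ((hdec hm ht (min_le_left _ _)).trans h0.le) zero_le)
  have h2 := mul_ofReal_le_lintegral (antitoneOn_coe hdec) hm
  refine ((lt_of_lt_of_le ?_ h2).trans_le (primitive_mono w (min_le_right t r))).ne'
  exact ENNReal.mul_pos (by simpa using h1) (by simpa using hm)

lemma ofReal_mul_inv_primitive_le (hdec : AntitoneOn w (Ioi 0)) {r : ℝ} (hr : 0 < r) :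
    ENNReal.ofReal r * (primitive w r)⁻¹ ≤ (w r : ℝ≥0∞)⁻¹ := by
  have h := mul_ofReal_le_lintegral (antitoneOn_coe hdec) hr
  rcases eq_or_ne (w r) 0 with h0 | h0
  · simp [h0]
  rw [← div_eq_mul_inv]
  refine ENNReal.div_le_of_le_mul ?_
  calc ENNReal.ofReal r = (w r : ℝ≥0∞)⁻¹ * (w r * ENNReal.ofReal r) := by
        rw [← mul_assoc, ENNReal.inv_mul_cancel (by simpa using h0) ENNReal.coe_ne_top, one_mul]
    _ ≤ _ := by gcongr; exact h

/-- The weight is bounded and integrable on `(0,∞)`. -/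
def IsBddIntegrable (w : ℝ → ℝ≥0) : Prop :=
  (∃ K : ℝ≥0, ∀ t, 0 < t → w t ≤ K) ∧ ∫⁻ t in Ioi 0, (w t : ℝ≥0∞) ≠ ∞

/-- If $w(r_k)>k$, then $r_k/W(r_k)\le 1/k$ and `kernel_le_div` gives the pointwise decay. If $w$ is
not integrable, take $W(r_k)\ge k$ and use `kernel_le_one`. -/
lemma isBddIntegrable_of_space_lambda_eq_gamma {n : ℕ} (hn : 0 < n) {v : ℝ → ℝ≥0}
    (hw : IsWeight w) (hdec : AntitoneOn w (Ioi 0)) (hv : Measurable v) {q : ℝ} (hq : 1 < q)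
    (heq : space (lambdaNorm n 1 w) = space (gammaNorm n q v)) : IsBddIntegrable w := by
  by_cases hne : ∃ t, 0 < t ∧ w t ≠ 0
  swap
  · push Not at hne
    refine ⟨⟨0, fun t ht => (hne t ht).le⟩, ?_⟩
    rw [setLIntegral_congr_fun (g := fun _ => 0) measurableSet_Ioi fun t ht => by simp [hne t ht]]
    simp
  have hinv : Tendsto (fun k : ℕ => (k : ℝ≥0∞)⁻¹) atTop (𝓝 0) :=
    ENNReal.tendsto_inv_nat_nhds_zero
  refine ⟨?_, ?_⟩
  · by_contra! hK
    choose r hr hwr using fun k : ℕ => hK (k : ℝ≥0)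
    refine space_lambda_ne_space_gamma hn hw.measurable hv hq (r := r)
      (fun k => primitive_pos hdec hne (hr k)) (fun k => hw.primitive_ne_top _) (fun t ht => ?_) heq
    have ht0 : (ENNReal.ofReal t)⁻¹ ≠ ∞ := by simpa using ht
    refine tendsto_of_tendsto_of_tendsto_of_le_of_le tendsto_const_nhds
      (by simpa using ENNReal.Tendsto.mul_const hinv (Or.inr ht0)) (fun _ => zero_le)
      fun k => ?_
    calc (primitive w (r k))⁻¹ * kernel (r k) t
        ≤ (primitive w (r k))⁻¹ * (ENNReal.ofReal (r k) / ENNReal.ofReal t) := by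
          gcongr; exact kernel_le_div _ _
      _ = ENNReal.ofReal (r k) * (primitive w (r k))⁻¹ * (ENNReal.ofReal t)⁻¹ := by
          rw [div_eq_mul_inv]; ring
      _ ≤ (k : ℝ≥0∞)⁻¹ * (ENNReal.ofReal t)⁻¹ := by
          gcongr
          refine (ofReal_mul_inv_primitive_le hdec (hr k)).trans (ENNReal.inv_le_inv.2 ?_)
          exact_mod_cast (hwr k).le
  · intro htop
    have hex : ∀ k : ℕ, ∃ r, 0 < r ∧ (k : ℝ≥0∞) ≤ primitive w r := by
      intro k
      by_contra! hk
      have := lintegral_Ioi_zero_le_of_forall_Ioc fun r hr => (hk r hr).le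
      rw [htop] at this
      exact absurd this (by simp)
    choose r hr hWr using hex
    refine space_lambda_ne_space_gamma hn hw.measurable hv hq (r := r)
      (fun k => primitive_pos hdec hne (hr k)) (fun k => hw.primitive_ne_top _) (fun t ht => ?_) heq
    refine tendsto_of_tendsto_of_tendsto_of_le_of_le tendsto_const_nhds hinv (fun _ => zero_le)
      fun k => ?_
    calc (primitive w (r k))⁻¹ * kernel (r k) t ≤ (k : ℝ≥0∞)⁻¹ * 1 :=
          mul_le_mul' (ENNReal.inv_le_inv.2 (hWr k)) (kernel_le_one _ _)
      _ = _ := mul_one _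

end Weight

/-! ### Comparing `Λ¹(w)` with `Γ^{1,∞}(w)` -/

/-- While $x_N\le1$, doubling bounds the partial sum by $x_N$. Afterwards $2y_N$ pays for all
remaining terms by halving; the crossing costs at most $2+2$. -/
lemma tsum_min_le_four {x y : ℕ → ℝ≥0∞} (hx : ∀ j, 2 * x j ≤ x (j + 1))
    (hy : ∀ j, 2 * y (j + 1) ≤ y j) (h : ∀ j, min (x j) (y j) ≤ 1) :
    ∑' j, min (x j) (y j) ≤ 4 := by
  have hsum : ∀ N, ∑ j ∈ Finset.range N, min (x j) (y j) ≤ x N := by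
    intro N
    induction N with
    | zero => simp
    | succ N ih =>
      rw [Finset.sum_range_succ]
      refine le_trans ?_ (hx N)
      rw [two_mul]
      exact add_le_add ih (min_le_left _ _)
  have hinv : ∀ N, x N ≤ 1 ∨ ∑ j ∈ Finset.range N, min (x j) (y j) + 2 * y N ≤ 4 := by
    have h24 : (2 : ℝ≥0∞) + 2 * 1 = 4 := by norm_num
    intro N
    induction N with
    | zero =>
      rcases min_le_iff.1 (h 0) with h0 | h0
      · exact Or.inl h0
      · right
        rw [Finset.range_zero, Finset.sum_empty, zero_add, ← h24]
        exact le_add_left (by gcongr)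
    | succ N ih =>
      rcases min_le_iff.1 (h (N + 1)) with h0 | h0
      · exact Or.inl h0
      · right
        rw [Finset.sum_range_succ]
        rcases ih with h1 | h1
        · rw [← h24]
          gcongr
          calc _ ≤ x N + x N := add_le_add (hsum N) (min_le_left _ _)
            _ ≤ 1 + 1 := add_le_add h1 h1
            _ = 2 := one_add_one_eq_two
        · refine le_trans ?_ h1
          rw [add_assoc, two_mul (y N)]
          gcongr
          · exact min_le_right _ _
          · exact hy N
  rw [ENNReal.tsum_eq_iSup_nat]
  refine iSup_le fun N => ?_
  rcases hinv N with h1 | h1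
  · exact (hsum N).trans (h1.trans (by norm_num))
  · exact le_self_add.trans h1

section Weight

variable {w : ℝ → ℝ≥0}

lemma tendsto_primitive_zero (hw : IsWeight w) :
    Tendsto (primitive w) (𝓝[>] 0) (𝓝 0) := by
  have h1 : Tendsto (fun r : ℝ => (volume.restrict (Ioc (0 : ℝ) 1)) (Ioc 0 r)) (𝓝[>] 0) (𝓝 0) := by
    refine tendsto_of_tendsto_of_tendsto_of_le_of_le (h := fun r => ENNReal.ofReal r)
      tendsto_const_nhds ?_ (fun _ => zero_le) fun r => ?_
    · simpa using (ENNReal.continuous_ofReal.tendsto 0).mono_left (nhdsWithin_le_nhds (s := Ioi 0))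
    · refine (Measure.restrict_apply_le _ _).trans ?_
      simp
  have h2 := tendsto_setLIntegral_zero (μ := volume.restrict (Ioc (0 : ℝ) 1))
    (f := fun t => (w t : ℝ≥0∞)) (hw.primitive_ne_top 1) h1
  refine h2.congr' ?_
  filter_upwards [Ioc_mem_nhdsGT (zero_lt_one' ℝ)] with r hr
  rw [Measure.restrict_restrict measurableSet_Ioc,
    inter_eq_left.2 (Ioc_subset_Ioc_right hr.2), primitive]

/-- For unbounded $w$ both $W(r)$ and $r/W(r)$ tend to $0$ as $r\to0$. So $r_j$ can be chosen with
$1/W(r_j)$ at least doubling and $r_j/W(r_j)$ at least halving. Each term of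
$\sum_j\chi_{(0,r_j)}/W(r_j)$ adds $1$ to the $\Lambda^1$ norm, while the $\Gamma^{1,\infty}$ norm
stays at most $4$. -/
lemma isBddIntegrable_of_space_lambda_eq_gammaWeak {n : ℕ} (hn : 0 < n)
    (hw : IsWeight w) (hdec : AntitoneOn w (Ioi 0)) (hint : ∫⁻ t in Ioi 0, (w t : ℝ≥0∞) ≠ ∞)
    (heq : space (lambdaNorm n 1 w) = space (gammaWeakNorm n 1 w)) : IsBddIntegrable w := by
  refine ⟨?_, hint⟩
  by_contra! hK
  have hne : ∃ t, 0 < t ∧ w t ≠ 0 := by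
    obtain ⟨t, ht, hwt⟩ := hK 0
    exact ⟨t, ht, hwt.ne'⟩
  have hWpos : ∀ {r}, 0 < r → primitive w r ≠ 0 := fun hr => primitive_pos hdec hne hr
  have hWtop := hw.primitive_ne_top
  have hφ : Tendsto (fun r => ENNReal.ofReal r * (primitive w r)⁻¹) (𝓝[>] 0) (𝓝 0) := by
    rw [ENNReal.tendsto_nhds_zero]
    intro ε hε
    obtain ⟨k, hk⟩ := ENNReal.exists_inv_nat_lt hε.ne'
    obtain ⟨t, ht, hwt⟩ := hK k
    filter_upwards [Ioc_mem_nhdsGT ht] with r hr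
    refine (ofReal_mul_inv_primitive_le hdec hr.1).trans (le_trans (ENNReal.inv_le_inv.2 ?_) hk.le)
    exact_mod_cast hwt.le.trans (hdec hr.1 ht hr.2)
  have hstep : ∀ r : Ioi (0 : ℝ), ∃ s : Ioi (0 : ℝ),
      2 * (primitive w r)⁻¹ ≤ (primitive w s)⁻¹ ∧
      2 * (ENNReal.ofReal s * (primitive w s)⁻¹) ≤ ENNReal.ofReal r * (primitive w r)⁻¹ := by
    rintro ⟨r, hr⟩
    have hW0 : Tendsto (fun s => 2 * primitive w s) (𝓝[>] 0) (𝓝 0) := by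
      simpa using ENNReal.Tendsto.const_mul (tendsto_primitive_zero hw) (Or.inr (by simp))
    have hφ0 : Tendsto (fun s => 2 * (ENNReal.ofReal s * (primitive w s)⁻¹)) (𝓝[>] 0) (𝓝 0) := by
      simpa using ENNReal.Tendsto.const_mul hφ (Or.inr (by simp))
    have hpos : 0 < ENNReal.ofReal r * (primitive w r)⁻¹ :=
      ENNReal.mul_pos (by simpa using hr) (ENNReal.inv_ne_zero.2 (hWtop r))
    obtain ⟨s, h1, h2, h3⟩ := ((hW0.eventually_le_const (pos_iff_ne_zero.2 (hWpos hr))).and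
      ((hφ0.eventually_le_const hpos).and self_mem_nhdsWithin)).exists
    refine ⟨⟨s, h3⟩, ?_, h2⟩
    calc 2 * (primitive w r)⁻¹ ≤ 2 * (2 * primitive w s)⁻¹ := by gcongr
      _ = (primitive w s)⁻¹ := by
        rw [ENNReal.mul_inv (by simp) (by simp), ← mul_assoc,
          ENNReal.mul_inv_cancel (by simp) (by simp), one_mul]
  choose next hnext1 hnext2 using hstep
  let ρ : ℕ → Ioi (0 : ℝ) := fun N => Nat.rec ⟨1, mem_Ioi.2 one_pos⟩ (fun _ => next) N
  have hρ : ∀ N, ρ (N + 1) = next (ρ N) := fun N => rfl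
  set r : ℕ → ℝ := fun j => (ρ j).1
  have hr : ∀ j, 0 < r j := fun j => (ρ j).2
  set c : ℕ → ℝ≥0∞ := fun j => (primitive w (r j))⁻¹ with hc
  have hc1 : ∀ j, 2 * c j ≤ c (j + 1) := fun j => hnext1 (ρ j)
  have hc2 : ∀ j, 2 * (ENNReal.ofReal (r (j + 1)) * c (j + 1)) ≤ ENNReal.ofReal (r j) * c j :=
    fun j => hnext2 (ρ j)
  have hcW : ∀ j, c j * primitive w (r j) = 1 := fun j =>
    ENNReal.inv_mul_cancel (hWpos (hr j)) (hWtop _)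
  have hS : ∀ t, 0 < t → (∑' j, c j * kernel (r j) t) * primitive w t ≤ 4 := by
    intro t ht
    have ht0 : ENNReal.ofReal t ≠ 0 := by simpa using ht
    -- Here $x_j=W(t)/W(r_j)$ and $y_j=(W(t)/t)\,(r_j/W(r_j))$. The smaller is at most $1$: $W$
    -- increases, which serves $t\le r_j$, and $W(t)/t$ decreases, which serves $r_j\le t$.
    rw [← ENNReal.tsum_mul_right]
    refine le_trans (ENNReal.tsum_le_tsum fun j => ?_) (tsum_min_le_four
      (x := fun j => c j * primitive w t)
      (y := fun j => ENNReal.ofReal (r j) * c j * (primitive w t / ENNReal.ofReal t))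
      (fun j => ?_) (fun j => ?_) (fun j => ?_))
    · refine le_min ?_ ?_
      · rw [mul_right_comm]; exact mul_le_of_le_one_right' (kernel_le_one _ _)
      · calc c j * kernel (r j) t * primitive w t
            ≤ c j * (ENNReal.ofReal (r j) / ENNReal.ofReal t) * primitive w t := by
              gcongr; exact kernel_le_div _ _
          _ = _ := by rw [div_eq_mul_inv, div_eq_mul_inv]; ring
    · rw [← mul_assoc]; gcongr; exact hc1 j
    · rw [← mul_assoc]
      exact mul_le_mul_left (hc2 j) _
    · rcases le_total t (r j) with h | h
      · exact (min_le_left _ _).trans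
          ((mul_le_mul_right (primitive_mono w h) _).trans (hcW j).le)
      · refine (min_le_right _ _).trans ?_
        have h1 := lintegral_mul_ofReal_le (antitoneOn_coe hdec) (hr j) h
        calc ENNReal.ofReal (r j) * c j * (primitive w t / ENNReal.ofReal t)
            = c j * (primitive w t * ENNReal.ofReal (r j)) / ENNReal.ofReal t := by
              rw [div_eq_mul_inv, div_eq_mul_inv]; ring
          _ ≤ c j * (primitive w (r j) * ENNReal.ofReal t) / ENNReal.ofReal t := by
              exact ENNReal.div_le_div_right (mul_le_mul_right h1 _) _
          _ = 1 := by
              rw [← mul_assoc, hcW, one_mul, ENNReal.div_self ht0 ENNReal.ofReal_ne_top]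
  have hfin : ∀ t, 0 < t → stepFun c r t ≠ ∞ := by
    intro t ht htop
    have h1 := hS t ht
    have h2 := stepFun_le (c := c) (r := r) ht
    rw [htop, top_le_iff] at h2
    rw [h2, ENNReal.top_mul (hWpos ht)] at h1
    exact absurd h1 (by simp)
  have hG := antitone_stepFun c r
  have h1 : radial n (stepFun c r) ∈ space (gammaWeakNorm n 1 w) := by
    refine ⟨measurable_radial hG, lt_of_le_of_lt (iSup₂_le fun t ht => ?_)
      (show (4 : ℝ≥0∞) < ∞ by simp)⟩
    rw [maxRearr_radial hn hG hfin, lintegral_stepFun_Ioc, div_one, ENNReal.rpow_one]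
    exact hS t ht
  rw [← heq] at h1
  have h2 := h1.2
  rw [lambdaNorm_radial hn hG hfin, lintegral_stepFun_mul c hw.measurable] at h2
  simp only [hcW] at h2
  rw [ENNReal.tsum_const_eq_top_of_ne_zero one_ne_zero] at h2
  exact lt_irrefl _ h2

end Weight

/-! ### Bounded integrable weights -/

lemma exists_nnreal_bound {a b : ℝ≥0∞} (ha : a ≠ ∞) (hb : b ≠ ∞) :
    ∃ C : ℝ≥0, 1 < C ∧ a ≤ C ∧ b ≤ C := by
  lift a to ℝ≥0 using ha
  lift b to ℝ≥0 using hb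
  refine ⟨2 + a + b, ?_, ?_, ?_⟩
  · exact (one_lt_two).trans_le (by rw [add_assoc]; exact le_self_add)
  · exact ENNReal.coe_le_coe.2 (by rw [add_right_comm]; exact le_add_self)
  · exact ENNReal.coe_le_coe.2 le_add_self

/-- `ρ` is equivalent to `f**(1)`, the norm of `L¹ + L^∞`. -/
def EquivMaxRearrOne {n : ℕ} (ρ : (Euc n → ℝ≥0) → ℝ≥0∞) : Prop :=
  ∃ a b : ℝ≥0∞, a ≠ ∞ ∧ b ≠ ∞ ∧ ∀ f, ρ f ≤ a * maxRearr f 1 ∧ maxRearr f 1 ≤ b * ρ f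

lemma EquivMaxRearrOne.normEquiv {n : ℕ} {ρ σ : (Euc n → ℝ≥0) → ℝ≥0∞} (hρ : EquivMaxRearrOne ρ)
    (hσ : EquivMaxRearrOne σ) : NormEquiv ρ σ := by
  obtain ⟨a, b, ha, hb, h⟩ := hρ
  obtain ⟨a', b', ha', hb', h'⟩ := hσ
  obtain ⟨C, hC, h1, h2⟩ :=
    exists_nnreal_bound (ENNReal.mul_ne_top ha hb') (ENNReal.mul_ne_top ha' hb)
  refine ⟨C, hC, fun f _ => ⟨?_, ?_⟩⟩
  · calc ρ f ≤ a * (b' * σ f) := (h f).1.trans (by gcongr; exact (h' f).2)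
      _ ≤ C * σ f := by rw [← mul_assoc]; gcongr
  · calc σ f ≤ a' * (b * ρ f) := (h' f).1.trans (by gcongr; exact (h f).2)
      _ ≤ C * ρ f := by rw [← mul_assoc]; gcongr

lemma NormEquiv.space_eq {n : ℕ} {ρ σ : (Euc n → ℝ≥0) → ℝ≥0∞} (h : NormEquiv ρ σ) :
    space ρ = space σ := by
  obtain ⟨C, -, h⟩ := h
  ext f
  refine and_congr_right fun hf => ⟨fun h1 => ?_, fun h1 => ?_⟩
  · exact (h f hf).2.trans_lt (ENNReal.mul_lt_top ENNReal.coe_lt_top h1)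
  · exact (h f hf).1.trans_lt (ENNReal.mul_lt_top ENNReal.coe_lt_top h1)

lemma normEquiv_of_eq_zero {n : ℕ} {ρ σ : (Euc n → ℝ≥0) → ℝ≥0∞} (hρ : ∀ f, ρ f = 0)
    (hσ : ∀ f, σ f = 0) : NormEquiv ρ σ :=
  ⟨2, one_lt_two, fun f _ => by simp [hρ, hσ]⟩

/-! ### Monotonicity of $f^*$, $f^{**}$ and $t f^{**}(t)$ -/

section Rearr

variable {n : ℕ} (f : Euc n → ℝ≥0)

lemma antitone_rearr : Antitone (rearr f) := fun _ _ hst =>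
  le_iInf₂ fun u hu => iInf₂_le u (hu.trans (ENNReal.ofReal_le_ofReal hst))

lemma maxRearr_one : maxRearr f 1 = ∫⁻ s in Ioc 0 1, rearr f s := by
  simp [maxRearr]

lemma maxRearr_mul_ofReal {t : ℝ} (ht : 0 < t) :
    maxRearr f t * ENNReal.ofReal t = ∫⁻ s in Ioc 0 t, rearr f s :=
  ENNReal.div_mul_cancel (by simpa using ht) ENNReal.ofReal_ne_top

lemma maxRearr_anti {s t : ℝ} (hs : 0 < s) (hst : s ≤ t) : maxRearr f t ≤ maxRearr f s := by
  have ht := hs.trans_le hst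
  have h := lintegral_mul_ofReal_le ((antitone_rearr f).antitoneOn (Ioi 0)) hs hst
  refine ENNReal.div_le_of_le_mul ?_
  rw [maxRearr, div_eq_mul_inv, mul_right_comm, ← div_eq_mul_inv]
  rwa [ENNReal.le_div_iff_mul_le (by simp [hs]) (by simp)]

lemma maxRearr_mul_ofReal_mono {s t : ℝ} (hs : 0 < s) (hst : s ≤ t) :
    maxRearr f s * ENNReal.ofReal s ≤ maxRearr f t * ENNReal.ofReal t := by
  rw [maxRearr_mul_ofReal f hs, maxRearr_mul_ofReal f (hs.trans_le hst)]
  exact lintegral_mono_set (Ioc_subset_Ioc_right hst)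

lemma rearr_le_maxRearr {t : ℝ} (ht : 0 < t) : rearr f t ≤ maxRearr f t := by
  rw [maxRearr, ENNReal.le_div_iff_mul_le (by simp [ht]) (by simp)]
  exact mul_ofReal_le_lintegral ((antitone_rearr f).antitoneOn (Ioi 0)) ht

end Rearr

/-! ### Reduction of the norms to $f^{**}(1)$ -/

section Weight

variable {w : ℝ → ℝ≥0}

/-- `∫₀^∞ w` bounds `W`, and so does `K t` if `w ≤ K`. -/
lemma IsBddIntegrable.primitive_le (hw : IsBddIntegrable w) :
    ∃ D : ℝ≥0∞, D ≠ ∞ ∧ ∀ r, 0 < r → primitive w r ≤ D * ENNReal.ofReal (min 1 r) := by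
  obtain ⟨⟨K, hK⟩, hI⟩ := hw
  refine ⟨K + ∫⁻ t in Ioi 0, (w t : ℝ≥0∞), ENNReal.add_ne_top.2 ⟨ENNReal.coe_ne_top, hI⟩,
    fun r hr => ?_⟩
  rcases le_total 1 r with h | h
  · rw [min_eq_left h, ENNReal.ofReal_one, mul_one]
    exact (lintegral_mono_set Ioc_subset_Ioi_self).trans le_add_self
  · rw [min_eq_right h, add_mul]
    refine le_trans ?_ le_self_add
    calc primitive w r ≤ ∫⁻ _ in Ioc 0 r, (K : ℝ≥0∞) :=
          setLIntegral_mono' measurableSet_Ioc fun s hs => ENNReal.coe_le_coe.2 (hK s hs.1)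
      _ = _ := by simp

lemma mul_ofReal_min_le_primitive (hdec : AntitoneOn w (Ioi 0)) {r : ℝ} (hr : 0 < r) :
    primitive w 1 * ENNReal.ofReal (min 1 r) ≤ primitive w r := by
  rcases le_total 1 r with h | h
  · rw [min_eq_left h, ENNReal.ofReal_one, mul_one]
    exact primitive_mono w h
  · rw [min_eq_right h]
    simpa [primitive] using lintegral_mul_ofReal_le (antitoneOn_coe hdec) hr h

/-- Above: $w\le K$ on $(0,1]$, and $f^*\le f^{**}(1)$ on $(1,\infty)$, where $w$ is integrable.
Below: keep only $(0,a]$ with $a\le1$ and $w(a)>0$, where $f^{**}(1)\le f^{**}(a)$. -/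
lemma equivMaxRearrOne_lambdaNorm (n : ℕ) (hwm : Measurable w) (hdec : AntitoneOn w (Ioi 0))
    (hw : IsBddIntegrable w) (hne : ∃ t, 0 < t ∧ w t ≠ 0) : EquivMaxRearrOne (lambdaNorm n 1 w) := by
  obtain ⟨⟨K, hK⟩, hI⟩ := hw
  obtain ⟨t, ht, hwt⟩ := hne
  set a := min t 1 with ha
  have ha0 : 0 < a := lt_min ht one_pos
  have hwa : w a ≠ 0 := fun h0 =>
    hwt (le_antisymm ((hdec ha0 ht (min_le_left _ _)).trans h0.le) zero_le)
  refine ⟨K + ∫⁻ t in Ioi 0, (w t : ℝ≥0∞), (ENNReal.ofReal a * w a)⁻¹,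
    ENNReal.add_ne_top.2 ⟨ENNReal.coe_ne_top, hI⟩,
    ENNReal.inv_ne_top.2 (mul_ne_zero (by simpa using ha0) (by simpa using hwa)), fun f => ?_⟩
  simp only [lambdaNorm, div_one, ENNReal.rpow_one]
  constructor
  · rw [← Ioc_union_Ioi_eq_Ioi zero_le_one,
      lintegral_union measurableSet_Ioi (Ioc_disjoint_Ioi le_rfl), add_mul]
    refine add_le_add ?_ ?_
    · rw [maxRearr_one, ← lintegral_const_mul _ (antitone_rearr f).measurable]
      refine setLIntegral_mono' measurableSet_Ioc fun s hs => ?_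
      rw [mul_comm]
      gcongr
      exact hK s hs.1
    · calc ∫⁻ s in Ioi 1, rearr f s * w s ≤ ∫⁻ s in Ioi 1, maxRearr f 1 * w s := by
            refine setLIntegral_mono' measurableSet_Ioi fun s hs => ?_
            gcongr
            exact (antitone_rearr f (le_of_lt hs)).trans (rearr_le_maxRearr f one_pos)
        _ = (∫⁻ s in Ioi 1, (w s : ℝ≥0∞)) * maxRearr f 1 := by
            rw [lintegral_const_mul _ hwm.coe_nnreal_ennreal, mul_comm]
        _ ≤ _ := mul_le_mul_left (lintegral_mono_set subset_union_right) _
  · have h1 : maxRearr f 1 * (ENNReal.ofReal a * w a) ≤ ∫⁻ s in Ioi 0, rearr f s * w s := by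
      calc maxRearr f 1 * (ENNReal.ofReal a * w a)
          ≤ maxRearr f a * (ENNReal.ofReal a * w a) := by
            gcongr; exact maxRearr_anti f ha0 (min_le_right _ _)
        _ = ∫⁻ s in Ioc 0 a, rearr f s * w a := by
            rw [← mul_assoc, maxRearr_mul_ofReal f ha0,
              lintegral_mul_const _ (antitone_rearr f).measurable]
        _ ≤ ∫⁻ s in Ioc 0 a, rearr f s * w s := by
            refine setLIntegral_mono' measurableSet_Ioc fun s hs => ?_
            gcongr
            exact hdec hs.1 ha0 hs.2
        _ ≤ _ := lintegral_mono_set Ioc_subset_Ioi_self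
    rw [mul_comm, ← div_eq_mul_inv]
    rwa [ENNReal.le_div_iff_mul_le (Or.inl (mul_ne_zero (by simpa using ha0) (by simpa using hwa)))
      (Or.inl (ENNReal.mul_ne_top ENNReal.ofReal_ne_top ENNReal.coe_ne_top))]

lemma equivMaxRearrOne_gammaWeakNorm (n : ℕ) (hw : IsWeight w) (hdec : AntitoneOn w (Ioi 0))
    (hwb : IsBddIntegrable w) (hne : ∃ t, 0 < t ∧ w t ≠ 0) :
    EquivMaxRearrOne (gammaWeakNorm n 1 w) := by
  obtain ⟨D, hD, hWD⟩ := hwb.primitive_le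
  have hW1 := primitive_pos hdec hne one_pos
  refine ⟨D, (primitive w 1)⁻¹, hD, ENNReal.inv_ne_top.2 hW1, fun f => ?_⟩
  simp only [gammaWeakNorm, div_one, ENNReal.rpow_one]
  constructor
  · refine iSup₂_le fun t ht => ?_
    calc maxRearr f t * primitive w t ≤ maxRearr f t * (D * ENNReal.ofReal (min 1 t)) := by
          gcongr; exact hWD t ht
      _ = D * (maxRearr f t * ENNReal.ofReal (min 1 t)) := by ring
      _ ≤ D * maxRearr f 1 := by
          gcongr
          rcases le_total 1 t with h | h
          · rw [min_eq_left h, ENNReal.ofReal_one, mul_one]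
            exact maxRearr_anti f one_pos h
          · rw [min_eq_right h]
            simpa using maxRearr_mul_ofReal_mono f ht h
  · calc maxRearr f 1 = (primitive w 1)⁻¹ * (maxRearr f 1 * primitive w 1) := by
          rw [mul_left_comm, ENNReal.inv_mul_cancel hW1 (hw.primitive_ne_top 1), mul_one]
      _ ≤ _ := by
          gcongr
          exact le_iSup₂ (f := fun (t : ℝ) (_ : 0 < t) => maxRearr f t * primitive w t) 1 one_pos

/-- Let $r\to\infty$ in the first term of $(*)$, using that $W$ is bounded; divide the second by
$r^q$ and let $r\to0$, using $W(r)\le Dr$. -/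
lemma IsWq.lintegral_le {q : ℝ} (hq : 0 < q) {u : ℝ → ℝ≥0} (hu : IsWq w q u)
    (hwb : IsBddIntegrable w) :
    ∫⁻ t in Ioi 0, (u t : ℝ≥0∞) ≠ ∞ ∧
      ∫⁻ t in Ioi 0, (u t : ℝ≥0∞) / ENNReal.ofReal (t ^ q) ≠ ∞ := by
  obtain ⟨D, hD, hWD⟩ := hwb.primitive_le
  obtain ⟨-, C, -, hC⟩ := hu
  have hCD : C * D ^ q ≠ ∞ :=
    ENNReal.mul_ne_top ENNReal.coe_ne_top (ENNReal.rpow_ne_top_of_nonneg hq.le hD)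
  constructor
  · refine ne_top_of_le_ne_top hCD (lintegral_Ioi_zero_le_of_forall_Ioc fun r hr => ?_)
    refine (le_self_add.trans (hC r hr).2).trans ?_
    gcongr
    refine (hWD r hr).trans (mul_le_of_le_one_right' ?_)
    rw [ENNReal.ofReal_le_one]
    exact min_le_left _ _
  · refine ne_top_of_le_ne_top hCD (lintegral_Ioi_zero_le_of_forall_Ioi fun r hr => ?_)
    have hrq : 0 < r ^ q := Real.rpow_pos_of_pos hr q
    have h1 : ENNReal.ofReal (r ^ q) * ∫⁻ x in Ioi r, (u x : ℝ≥0∞) / ENNReal.ofReal (x ^ q)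
        ≤ ENNReal.ofReal (r ^ q) * (C * D ^ q) := by
      refine (le_add_self.trans (hC r hr).2).trans ?_
      rw [mul_left_comm]
      gcongr
      rw [← ENNReal.ofReal_rpow_of_pos hr, ← ENNReal.mul_rpow_of_nonneg _ _ hq.le, mul_comm _ D]
      gcongr
      refine (hWD r hr).trans ?_
      gcongr
      exact min_le_right _ _
    exact (ENNReal.mul_le_mul_iff_right (by simpa using hrq) ENNReal.ofReal_ne_top).1 h1

/-- The upper bound uses $f^{**}(t)\le\max(1,1/t)f^{**}(1)$ and the two finite integrals of $u$; the
lower bound uses $f^{**}(t)\ge\min(1,1/t)f^{**}(1)$ and $(*)$ at $r=1$ only. -/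
lemma equivMaxRearrOne_gammaNorm (n : ℕ) (hw : IsWeight w) (hdec : AntitoneOn w (Ioi 0))
    (hwb : IsBddIntegrable w) (hne : ∃ t, 0 < t ∧ w t ≠ 0) {q : ℝ} (hq : 0 < q) {u : ℝ → ℝ≥0}
    (hu : IsWq w q u) : EquivMaxRearrOne (gammaNorm n q u) := by
  obtain ⟨hfin1, hfin2⟩ := hu.lintegral_le hq hwb
  obtain ⟨hum, C, hC1, hC⟩ := hu
  have hmu := hum.measurable
  have hq1 : 0 < 1 / q := by positivity
  have hroot : ∀ x : ℝ≥0∞, (x ^ q) ^ (1 / q) = x := fun x => by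
    rw [← ENNReal.rpow_mul, mul_one_div_cancel hq.ne', ENNReal.rpow_one]
  set T := (∫⁻ t in Ioi 0, (u t : ℝ≥0∞)) + ∫⁻ t in Ioi 0, (u t : ℝ≥0∞) / ENNReal.ofReal (t ^ q) with hTdef
  have hT : T ≠ ∞ := ENNReal.add_ne_top.2 ⟨hfin1, hfin2⟩
  have hW1 := primitive_pos hdec hne one_pos
  have hW1q : primitive w 1 ^ q ≠ 0 := by simp [ENNReal.rpow_eq_zero_iff, hW1, hq.le]
  refine ⟨T ^ (1 / q), (C / primitive w 1 ^ q) ^ (1 / q),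
    ENNReal.rpow_ne_top_of_nonneg hq1.le hT,
    ENNReal.rpow_ne_top_of_nonneg hq1.le (ENNReal.div_ne_top ENNReal.coe_ne_top hW1q),
    fun f => ⟨?_, ?_⟩⟩
  · have hdiv : ∀ t, 0 < t → t ≤ 1 →
        maxRearr f t ^ q ≤ maxRearr f 1 ^ q / ENNReal.ofReal (t ^ q) := fun t ht h => by
      rw [← ENNReal.ofReal_rpow_of_pos ht, ← ENNReal.div_rpow_of_nonneg _ _ hq.le]
      refine ENNReal.rpow_le_rpow ?_ hq.le
      rw [ENNReal.le_div_iff_mul_le (by simp [ht]) (by simp)]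
      simpa using maxRearr_mul_ofReal_mono f ht h
    have h1 : ∫⁻ t in Ioi 0, maxRearr f t ^ q * u t ≤ T * maxRearr f 1 ^ q := by
      rw [mul_comm, hTdef, ← lintegral_add_left hmu.coe_nnreal_ennreal,
        ← lintegral_const_mul _ (by fun_prop)]
      refine setLIntegral_mono' measurableSet_Ioi fun t ht => ?_
      rw [mul_add]
      rcases le_total 1 t with h | h
      · refine le_trans ?_ le_self_add
        gcongr
        exact maxRearr_anti f one_pos h
      · refine le_trans (mul_le_mul_left (hdiv t ht h) _) (le_trans (le_of_eq ?_) le_add_self)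
        rw [div_eq_mul_inv, div_eq_mul_inv]; ring
    calc gammaNorm n q u f ≤ (T * maxRearr f 1 ^ q) ^ (1 / q) := ENNReal.rpow_le_rpow h1 hq1.le
      _ = _ := by rw [ENNReal.mul_rpow_of_nonneg _ _ hq1.le, hroot]
  · have hdiv : ∀ t, 1 ≤ t →
        maxRearr f 1 ^ q / ENNReal.ofReal (t ^ q) ≤ maxRearr f t ^ q := fun t h => by
      have ht : 0 < t := one_pos.trans_le h
      rw [← ENNReal.ofReal_rpow_of_pos ht, ← ENNReal.div_rpow_of_nonneg _ _ hq.le]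
      refine ENNReal.rpow_le_rpow (ENNReal.div_le_of_le_mul ?_) hq.le
      simpa using maxRearr_mul_ofReal_mono f one_pos h
    have h1 : maxRearr f 1 ^ q * (primitive u 1 + ∫⁻ x in Ioi 1, (u x : ℝ≥0∞) /
        ENNReal.ofReal (x ^ q)) ≤ ∫⁻ t in Ioi 0, maxRearr f t ^ q * u t := by
      rw [← Ioc_union_Ioi_eq_Ioi zero_le_one,
        lintegral_union measurableSet_Ioi (Ioc_disjoint_Ioi le_rfl), mul_add, primitive,
        ← lintegral_const_mul _ (by fun_prop), ← lintegral_const_mul _ (by fun_prop)]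
      refine add_le_add (setLIntegral_mono' measurableSet_Ioc fun t ht => ?_)
        (setLIntegral_mono' measurableSet_Ioi fun t ht => ?_)
      · gcongr
        exact maxRearr_anti f ht.1 ht.2
      · refine le_trans (le_of_eq ?_) (mul_le_mul_left (hdiv t (le_of_lt ht)) _)
        rw [div_eq_mul_inv, div_eq_mul_inv]; ring
    have h2 : primitive w 1 ^ q ≤ C * (primitive u 1 + ∫⁻ x in Ioi 1, (u x : ℝ≥0∞) /
        ENNReal.ofReal (x ^ q)) := by
      simpa using (hC 1 one_pos).1
    have h3 : maxRearr f 1 ^ q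
        ≤ C / primitive w 1 ^ q * ∫⁻ t in Ioi 0, maxRearr f t ^ q * u t := by
      have hWtop : primitive w 1 ^ q ≠ ∞ := ENNReal.rpow_ne_top_of_nonneg hq.le (hw.primitive_ne_top 1)
      calc maxRearr f 1 ^ q
          = maxRearr f 1 ^ q * primitive w 1 ^ q * (primitive w 1 ^ q)⁻¹ := by
            rw [mul_assoc, ENNReal.mul_inv_cancel hW1q hWtop, mul_one]
        _ ≤ maxRearr f 1 ^ q * (C * (primitive u 1 + ∫⁻ x in Ioi 1, (u x : ℝ≥0∞) /
              ENNReal.ofReal (x ^ q))) * (primitive w 1 ^ q)⁻¹ := by gcongr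
        _ = C / primitive w 1 ^ q * (maxRearr f 1 ^ q * (primitive u 1 + ∫⁻ x in Ioi 1,
              (u x : ℝ≥0∞) / ENNReal.ofReal (x ^ q))) := by rw [div_eq_mul_inv]; ring
        _ ≤ _ := by gcongr
    calc maxRearr f 1 = (maxRearr f 1 ^ q) ^ (1 / q) := (hroot _).symm
      _ ≤ _ := ENNReal.rpow_le_rpow h3 hq1.le
      _ = _ := by rw [ENNReal.mul_rpow_of_nonneg _ _ hq1.le, gammaNorm]

/-- `χ_{(1,2]}` is a weight `w_q` for every nonzero bounded integrable decreasing weight. -/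
lemma isWq_indicator (hw : IsWeight w) (hdec : AntitoneOn w (Ioi 0)) (hwb : IsBddIntegrable w)
    (hne : ∃ t, 0 < t ∧ w t ≠ 0) {q : ℝ} (hq : 0 < q) :
    IsWq w q ((Ioc (1 : ℝ) 2).indicator 1) := by
  set u : ℝ → ℝ≥0 := (Ioc (1 : ℝ) 2).indicator 1 with hu
  have hum : Measurable u := measurable_one.indicator measurableSet_Ioc
  have hu0 : ∀ x, x ∉ Ioc (1 : ℝ) 2 → u x = 0 := fun x hx => indicator_of_notMem hx _
  have hucoe : (fun x => (u x : ℝ≥0∞)) = (Ioc (1 : ℝ) 2).indicator 1 := by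
    funext x
    by_cases hx : x ∈ Ioc (1 : ℝ) 2 <;> simp [hu, hx]
  have hureal : (fun x => (u x : ℝ)) = (Ioc (1 : ℝ) 2).indicator 1 := by
    funext x
    by_cases hx : x ∈ Ioc (1 : ℝ) 2 <;> simp [hu, hx]
  have huw : IsWeight u := by
    refine ⟨hum, ?_⟩
    rw [hureal]
    exact (((integrable_indicator_iff measurableSet_Ioc).2
      (integrableOn_const (by simp) (by simp))).locallyIntegrable).locallyIntegrableOn _
  have htotal : ∀ S : Set ℝ, MeasurableSet S → ∫⁻ x in S, (u x : ℝ≥0∞) = volume (Ioc 1 2 ∩ S) := by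
    intro S hS
    rw [hucoe, lintegral_indicator_one measurableSet_Ioc,
      Measure.restrict_apply measurableSet_Ioc]
  have hle1 : ∀ S : Set ℝ, MeasurableSet S → ∫⁻ x in S, (u x : ℝ≥0∞) ≤ 1 := by
    intro S hS
    rw [htotal S hS]
    refine (measure_mono inter_subset_left).trans ?_
    rw [Real.volume_Ioc]; norm_num
  have hprim0 : ∀ r : ℝ, r ≤ 1 → primitive u r = 0 := by
    intro r hr
    rw [primitive, htotal _ measurableSet_Ioc]
    convert measure_empty (μ := (volume : Measure ℝ))
    ext x
    simp only [mem_inter_iff, mem_Ioc, mem_empty_iff_false, iff_false]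
    grind
  have hsum : ∀ r : ℝ, 0 < r → primitive u r + ∫⁻ x in Ioi r, (u x : ℝ≥0∞) = 1 := by
    intro r hr
    rw [primitive, ← lintegral_union measurableSet_Ioi (Ioc_disjoint_Ioi le_rfl),
      Ioc_union_Ioi_eq_Ioi hr.le, htotal _ measurableSet_Ioi, inter_eq_left.2
      (Ioc_subset_Ioi_self.trans (Ioi_subset_Ioi zero_le_one)), Real.volume_Ioc]
    norm_num
  -- For $x>r$ in $(1,2]$ one has $r/2\le r/x\le\min(1,r)$. So the right side of $(*)$, like
  -- $W(r)^q$, is comparable to $\min(1,r)^q$.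
  have hupper : ∀ r : ℝ, 0 < r →
      ENNReal.ofReal (r ^ q) * ∫⁻ x in Ioi r, (u x : ℝ≥0∞) / ENNReal.ofReal (x ^ q)
        ≤ ENNReal.ofReal (min 1 r) ^ q := by
    intro r hr
    rw [← lintegral_const_mul _ (by fun_prop)]
    calc ∫⁻ x in Ioi r, ENNReal.ofReal (r ^ q) * ((u x : ℝ≥0∞) / ENNReal.ofReal (x ^ q))
        ≤ ∫⁻ x in Ioi r, ENNReal.ofReal (min 1 r) ^ q * u x := by
          refine setLIntegral_mono' measurableSet_Ioi fun x hx => ?_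
          by_cases hxI : x ∈ Ioc (1 : ℝ) 2
          · have hx0 : 0 < x := zero_lt_one.trans hxI.1
            rw [← mul_div_assoc, mul_comm, mul_div_assoc, mul_comm]
            gcongr
            rw [← ENNReal.ofReal_rpow_of_pos hr, ← ENNReal.ofReal_rpow_of_pos hx0,
              ← ENNReal.div_rpow_of_nonneg _ _ hq.le, ← ENNReal.ofReal_div_of_pos hx0]
            gcongr
            refine le_min ?_ ?_
            · exact (div_le_one hx0).2 (le_of_lt hx)
            · exact div_le_self hr.le hxI.1.le
          · simp [hu0 x hxI]
      _ = ENNReal.ofReal (min 1 r) ^ q * ∫⁻ x in Ioi r, (u x : ℝ≥0∞) := by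
          rw [lintegral_const_mul _ (by fun_prop)]
      _ ≤ _ := mul_le_of_le_one_right' (hle1 _ measurableSet_Ioi)
  have hlower : ∀ r : ℝ, 0 < r →
      ENNReal.ofReal (r / 2) ^ q * ∫⁻ x in Ioi r, (u x : ℝ≥0∞)
        ≤ ENNReal.ofReal (r ^ q) * ∫⁻ x in Ioi r, (u x : ℝ≥0∞) / ENNReal.ofReal (x ^ q) := by
    intro r hr
    rw [← lintegral_const_mul _ (by fun_prop), ← lintegral_const_mul _ (by fun_prop)]
    refine setLIntegral_mono' measurableSet_Ioi fun x hx => ?_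
    by_cases hxI : x ∈ Ioc (1 : ℝ) 2
    · have hx0 : 0 < x := zero_lt_one.trans hxI.1
      rw [← mul_div_assoc, mul_comm (ENNReal.ofReal (r ^ q)), mul_div_assoc,
        mul_comm (u x : ℝ≥0∞)]
      gcongr
      rw [← ENNReal.ofReal_rpow_of_pos hr, ← ENNReal.ofReal_rpow_of_pos hx0,
        ← ENNReal.div_rpow_of_nonneg _ _ hq.le, ← ENNReal.ofReal_div_of_pos hx0]
      gcongr
      exact hxI.2
    · simp [hu0 x hxI]
  have hB1 : ∀ r : ℝ, 0 < r → primitive u r + ENNReal.ofReal (r ^ q) *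
      ∫⁻ x in Ioi r, (u x : ℝ≥0∞) / ENNReal.ofReal (x ^ q)
        ≤ 2 * ENNReal.ofReal (min 1 r) ^ q := by
    intro r hr
    rw [two_mul]
    refine add_le_add ?_ (hupper r hr)
    rcases le_total 1 r with h | h
    · rw [min_eq_left h, ENNReal.ofReal_one, ENNReal.one_rpow]
      exact hle1 _ measurableSet_Ioc
    · rw [hprim0 r h]; exact zero_le
  have hB2 : ∀ r : ℝ, 0 < r → ENNReal.ofReal (min 1 r / 2) ^ q ≤ primitive u r +
      ENNReal.ofReal (r ^ q) * ∫⁻ x in Ioi r, (u x : ℝ≥0∞) / ENNReal.ofReal (x ^ q) := by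
    intro r hr
    have h1 : ENNReal.ofReal (min 1 r / 2) ^ q ≤ 1 := by
      refine ENNReal.rpow_le_one (ENNReal.ofReal_le_one.2 ?_) hq.le
      linarith [min_le_left 1 r]
    calc ENNReal.ofReal (min 1 r / 2) ^ q
        = ENNReal.ofReal (min 1 r / 2) ^ q * primitive u r
          + ENNReal.ofReal (min 1 r / 2) ^ q * ∫⁻ x in Ioi r, (u x : ℝ≥0∞) := by
          rw [← mul_add, hsum r hr, mul_one]
      _ ≤ primitive u r + ENNReal.ofReal (r / 2) ^ q * ∫⁻ x in Ioi r, (u x : ℝ≥0∞) := by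
          gcongr
          · exact mul_le_of_le_one_left' h1
          · exact min_le_right _ _
      _ ≤ _ := add_le_add_right (hlower r hr) _
  obtain ⟨D, hD, hWD⟩ := hwb.primitive_le
  have hW1 := primitive_pos hdec hne one_pos
  have hW1q : primitive w 1 ^ q ≠ 0 := by simp [ENNReal.rpow_eq_zero_iff, hW1, hq.le]
  obtain ⟨C, hC, hC1, hC2⟩ := exists_nnreal_bound (a := (D * 2) ^ q) (b := 2 / primitive w 1 ^ q)
    (ENNReal.rpow_ne_top_of_nonneg hq.le (ENNReal.mul_ne_top hD (by simp)))
    (ENNReal.div_ne_top (by simp) hW1q)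
  refine ⟨huw, C, hC, fun r hr => ⟨?_, ?_⟩⟩
  · calc primitive w r ^ q ≤ (D * ENNReal.ofReal (min 1 r)) ^ q := by gcongr; exact hWD r hr
      _ = (D * 2) ^ q * ENNReal.ofReal (min 1 r / 2) ^ q := by
          rw [← ENNReal.mul_rpow_of_nonneg _ _ hq.le, mul_assoc,
            ENNReal.ofReal_div_of_pos two_pos, ENNReal.ofReal_ofNat,
            ENNReal.mul_div_cancel (by simp) (by simp)]
      _ ≤ _ := mul_le_mul' hC1 (hB2 r hr)
  · calc _ ≤ 2 * ENNReal.ofReal (min 1 r) ^ q := hB1 r hr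
      _ = 2 / primitive w 1 ^ q * (primitive w 1 * ENNReal.ofReal (min 1 r)) ^ q := by
          rw [ENNReal.mul_rpow_of_nonneg _ _ hq.le, ← mul_assoc, ENNReal.div_mul_cancel hW1q
            (ENNReal.rpow_ne_top_of_nonneg hq.le (hw.primitive_ne_top 1))]
      _ ≤ _ := by
          gcongr
          exact mul_ofReal_min_le_primitive hdec hr

/-! ### The zero weight -/

lemma primitive_eq_zero (h0 : ∀ t, 0 < t → w t = 0) (r : ℝ) : primitive w r = 0 := by
  rw [primitive, setLIntegral_congr_fun (g := fun _ => 0) measurableSet_Ioc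
    fun t ht => by simp [h0 t ht.1]]
  simp

lemma lambdaNorm_eq_zero (h0 : ∀ t, 0 < t → w t = 0) {n : ℕ} (f : Euc n → ℝ≥0) :
    lambdaNorm n 1 w f = 0 := by
  rw [lambdaNorm, setLIntegral_congr_fun (g := fun _ => 0) measurableSet_Ioi
    fun t ht => by simp [h0 t ht]]
  simp

lemma gammaWeakNorm_eq_zero (h0 : ∀ t, 0 < t → w t = 0) {n : ℕ} (f : Euc n → ℝ≥0) :
    gammaWeakNorm n 1 w f = 0 := by
  simp [gammaWeakNorm, primitive_eq_zero h0]

lemma isWq_zero (h0 : ∀ t, 0 < t → w t = 0) {q : ℝ} (hq : 0 < q) : IsWq w q 0 := by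
  refine ⟨⟨measurable_zero, ?_⟩, 2, one_lt_two, fun r hr => ?_⟩
  · simpa using (locallyIntegrable_zero (μ := (volume : Measure ℝ)) (ε'' := ℝ)).locallyIntegrableOn _
  · simp [primitive_eq_zero h0, primitive_eq_zero (w := 0), ENNReal.zero_rpow_of_pos hq]

/-- With $W=0$, condition $(*)$ forces $u=0$ almost everywhere on $(0,\infty)$; then
$0\cdot\infty=0$ covers infinite $f^{**}$. -/
lemma gammaNorm_eq_zero (h0 : ∀ t, 0 < t → w t = 0) {n : ℕ} {q : ℝ} (hq : 0 < q) {u : ℝ → ℝ≥0}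
    (hu : IsWq w q u) (f : Euc n → ℝ≥0) : gammaNorm n q u f = 0 := by
  obtain ⟨hu, C, -, hC⟩ := hu
  have h1 : ∫⁻ t in Ioi 0, (u t : ℝ≥0∞) = 0 :=
    le_antisymm (lintegral_Ioi_zero_le_of_forall_Ioc fun r hr => by
      refine (le_self_add.trans (hC r hr).2).trans ?_
      simp [primitive_eq_zero h0, ENNReal.zero_rpow_of_pos hq]) zero_le
  rw [lintegral_eq_zero_iff hu.measurable.coe_nnreal_ennreal] at h1
  have h2 : ∫⁻ t in Ioi 0, maxRearr f t ^ q * (u t : ℝ≥0∞) = 0 := by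
    rw [← lintegral_zero (μ := volume.restrict (Ioi (0 : ℝ)))]
    refine lintegral_congr_ae ?_
    filter_upwards [h1] with t ht
    have ht' : (u t : ℝ≥0∞) = 0 := ht
    rw [ht', mul_zero]
  rw [gammaNorm, h2, ENNReal.zero_rpow_of_pos (by positivity)]

/-! ### Consequences of `IsBddIntegrable`, and the main theorem -/

lemma IsBddIntegrable.normEquiv_gammaNorm (n : ℕ) (hw : IsWeight w)
    (hdec : AntitoneOn w (Ioi 0)) (hwb : IsBddIntegrable w) {q : ℝ} (hq : 0 < q) :
    (∃ u : ℝ → ℝ≥0, IsWq w q u) ∧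
      ∀ u : ℝ → ℝ≥0, IsWq w q u → NormEquiv (lambdaNorm n 1 w) (gammaNorm n q u) := by
  by_cases hne : ∃ t, 0 < t ∧ w t ≠ 0
  · exact ⟨⟨_, isWq_indicator hw hdec hwb hne hq⟩, fun u hu =>
      (equivMaxRearrOne_lambdaNorm n hw.measurable hdec hwb hne).normEquiv
        (equivMaxRearrOne_gammaNorm n hw hdec hwb hne hq hu)⟩
  · push Not at hne
    exact ⟨⟨0, isWq_zero hne hq⟩, fun u hu =>
      normEquiv_of_eq_zero (lambdaNorm_eq_zero hne) (gammaNorm_eq_zero hne hq hu)⟩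

lemma IsBddIntegrable.normEquiv_gammaWeakNorm (n : ℕ) (hw : IsWeight w)
    (hdec : AntitoneOn w (Ioi 0)) (hwb : IsBddIntegrable w) :
    NormEquiv (lambdaNorm n 1 w) (gammaWeakNorm n 1 w) := by
  by_cases hne : ∃ t, 0 < t ∧ w t ≠ 0
  · exact (equivMaxRearrOne_lambdaNorm n hw.measurable hdec hwb hne).normEquiv
      (equivMaxRearrOne_gammaWeakNorm n hw hdec hwb hne)
  · push Not at hne
    exact normEquiv_of_eq_zero (lambdaNorm_eq_zero hne) (gammaWeakNorm_eq_zero hne)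

lemma lintegral_ne_top_iff_integrableOn (hw : Measurable w) :
    ∫⁻ t in Ioi 0, (w t : ℝ≥0∞) ≠ ∞ ↔ IntegrableOn (fun t => (w t : ℝ)) (Ioi 0) volume := by
  rw [← lt_top_iff_ne_top, IntegrableOn, Integrable, hasFiniteIntegral_iff_enorm]
  have h3 : ∀ t, ‖(w t : ℝ)‖ₑ = w t := fun t => by
    rw [Real.enorm_eq_ofReal (w t).coe_nonneg, ENNReal.ofReal_coe_nnreal]
  simp only [h3]
  exact (and_iff_right (by fun_prop)).symm

/-- Monotonicity gives $t\,w(t)\le\int_0^\infty w$. -/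
lemma IsBddIntegrable.tendsto (hdec : AntitoneOn w (Ioi 0)) (hwb : IsBddIntegrable w) :
    Tendsto w atTop (𝓝 0) := by
  rw [← ENNReal.tendsto_coe, ENNReal.coe_zero]
  have h1 : Tendsto (fun t => (∫⁻ t in Ioi 0, (w t : ℝ≥0∞)) / ENNReal.ofReal t) atTop (𝓝 0) := by
    have := ENNReal.Tendsto.const_mul (a := ∫⁻ t in Ioi 0, (w t : ℝ≥0∞))
      (tendsto_inv_iff.2 ENNReal.tendsto_ofReal_atTop) (Or.inr hwb.2)
    simpa [div_eq_mul_inv] using this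
  refine tendsto_of_tendsto_of_tendsto_of_le_of_le' tendsto_const_nhds h1
    (Eventually.of_forall fun _ => zero_le) ?_
  filter_upwards [eventually_gt_atTop 0] with t ht
  rw [ENNReal.le_div_iff_mul_le (by simp [ht]) (by simp)]
  exact (mul_ofReal_le_lintegral (antitoneOn_coe hdec) ht).trans
    (lintegral_mono_set Ioc_subset_Ioi_self)

end Weight

end WeightedLorentz

theorem mainTheorem7 (n : ℕ) (hn : 0 < n) (w : ℝ → ℝ≥0) (hw : IsWeight w)
    (hdec : AntitoneOn w (Ioi 0)) :
    List.TFAE [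
      -- (i), equality of sets
      ∃ q : ℝ, 1 < q ∧ ∃ v : ℝ → ℝ≥0, IsWeight v ∧
        space (lambdaNorm n 1 w) = space (gammaNorm n q v),
      -- (i), equality with equivalent norms
      ∃ q : ℝ, 1 < q ∧ ∃ v : ℝ → ℝ≥0, IsWeight v ∧
        NormEquiv (lambdaNorm n 1 w) (gammaNorm n q v),
      -- (ii), equality of sets
      ∀ q : ℝ, 1 < q → (∃ u : ℝ → ℝ≥0, IsWq w q u) ∧
        ∀ u : ℝ → ℝ≥0, IsWq w q u → space (lambdaNorm n 1 w) = space (gammaNorm n q u),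
      -- (ii), equality with equivalent norms
      ∀ q : ℝ, 1 < q → (∃ u : ℝ → ℝ≥0, IsWq w q u) ∧
        ∀ u : ℝ → ℝ≥0, IsWq w q u → NormEquiv (lambdaNorm n 1 w) (gammaNorm n q u),
      -- (iii), equality of sets
      space (lambdaNorm n 1 w) = space (gammaWeakNorm n 1 w) ∧
        Tendsto w atTop (𝓝 0) ∧ IntegrableOn (fun t => (w t : ℝ)) (Ioi 0) volume,
      -- (iii), equality with equivalent norms
      NormEquiv (lambdaNorm n 1 w) (gammaWeakNorm n 1 w) ∧
        Tendsto w atTop (𝓝 0) ∧ IntegrableOn (fun t => (w t : ℝ)) (Ioi 0) volume] := by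
  have of_gamma : (∃ q : ℝ, 1 < q ∧ ∃ v : ℝ → ℝ≥0, IsWeight v ∧
      space (lambdaNorm n 1 w) = space (gammaNorm n q v)) → IsBddIntegrable w := by
    rintro ⟨q, hq, v, hv, heq⟩
    exact isBddIntegrable_of_space_lambda_eq_gamma hn hw hdec hv.measurable hq heq
  tfae_have 2 → 1 := fun ⟨q, hq, v, hv, h⟩ => ⟨q, hq, v, hv, h.space_eq⟩
  -- Any exponent would do. The existence half of (ii) supplies the weight.
  tfae_have 4 → 2 := fun h => by
    obtain ⟨⟨u, hu⟩, h2⟩ := h 2 one_lt_two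
    exact ⟨2, one_lt_two, u, hu.1, h2 u hu⟩
  tfae_have 4 → 3 := fun h q hq => ⟨(h q hq).1, fun u hu => ((h q hq).2 u hu).space_eq⟩
  tfae_have 3 → 1 := fun h => by
    obtain ⟨⟨u, hu⟩, h2⟩ := h 2 one_lt_two
    exact ⟨2, one_lt_two, u, hu.1, h2 u hu⟩
  tfae_have 1 → 6 := fun h =>
    have hwb := of_gamma h
    ⟨hwb.normEquiv_gammaWeakNorm n hw hdec, hwb.tendsto hdec,
      (lintegral_ne_top_iff_integrableOn hw.measurable).1 hwb.2⟩
  tfae_have 6 → 5 := fun h => ⟨h.1.space_eq, h.2⟩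
  tfae_have 5 → 4 := fun h q hq =>
    (isBddIntegrable_of_space_lambda_eq_gammaWeak hn hw hdec
      ((lintegral_ne_top_iff_integrableOn hw.measurable).2 h.2.2) h.1).normEquiv_gammaNorm n hw
        hdec (one_pos.trans hq)
  tfae_finish
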